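/- Let $X$ be a complex manifold and $L$ a holomorphic line bundle on $X$. A \emph{contact form} on $X$ with values in $L$ is a holomorphic section $\theta\in H^0(X,\Omega^1_X\otimes L)$, viewed as a bundle map $\theta:T(X)\to L$, which is surjective at every point and such that the 2-form $d\theta$, computed in local trivializations of $L$, restricts to a non-degenerate form on $H_x=\ker\theta_x$ at every point $x\in X$ (this does not depend on the trivializations). Let $L^\times$ be the complement of the zero section in the total space of the dual bundle $L^*$, with projection $p:L^\times\to X$. Using the canonical trivialization of $p^*L$ on $L^\times$, view $p^*\theta$ as an ordinary holomorphic 1-form on $L^\times$: at $(x,a)$ with $0\neq a\in L_x^*$, it is $w\mapsto a\bigl(\theta_x(dp\,w)\bigr)$. A 2-form $\omega$ on $L^\times$ is \emph{symplectic} if it is holomorphic, closed and non-degenerate at every point, and $\mathbf C^*$-\emph{equivariant} if $\lambda^*\omega=\lambda\,\omega$ for every $\lambda\in\mathbf C^*$, where $\lambda$ acts on $L^\times$ by the homothety of the fibres. (1) For every contact form $\theta$ on $X$ with values in $L$, the 2-form $\omega=d(p^*\theta)$ on $L^\times$ is symplectic and $\mathbf C^*$-equivariant. (2) Conversely, for every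 $\mathbf C^*$-equivariant symplectic 2-form $\omega$ on $L^\times$ there is a unique contact form $\theta\in H^0(X,\Omega^1_X\otimes L)$ such that $\omega=d(p^*\theta)$. -/

import Mathlib

open scoped Manifold ContDiff Bundle Topology

noncomputable section

/-! ### Differential forms on a (complex) manifold -/

section Forms

variable {E : Type*} [NormedAddCommGroup E] [NormedSpace ℂ E]
  {H : Type*} [TopologicalSpace H] (I : ModelWithCorners ℂ E H)
  (M : Type*) [TopologicalSpace M] [ChartedSpace H M]

/-- A complex-valued `k`-form of type `(k, 0)` on `M`: at each point, a `ℂ`-multilinear alternating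
form on the holomorphic tangent space. No regularity is imposed here. -/
abbrev DiffForm (k : ℕ) : Type _ :=
  ∀ x : M, TangentSpace I x [⋀^Fin k]→L[ℂ] ℂ

variable {I M}

namespace DiffForm

/-- The expression of a form in the chart of `M` centred at `x`, that is, its pull-back by the
inverse of that chart. It is meaningful on the target of the chart. -/
def inChart {k : ℕ} (α : DiffForm I M k) (x : M) (y : E) : E [⋀^Fin k]→L[ℂ] ℂ :=
  (α ((extChartAt I x).symm y)).compContinuousLinearMap
    (mfderivWithin 𝓘(ℂ, E) I (extChartAt I x).symm (Set.range I) y)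

/-- A form is holomorphic if its expression in every chart is holomorphic. -/
def IsHolomorphic {k : ℕ} (α : DiffForm I M k) : Prop :=
  ∀ x : M, ContDiffOn ℂ ω (α.inChart x) (extChartAt I x).target

/-- The exterior derivative of a form, computed at `x` in the chart at `x`:
`dα = φ^* d((φ⁻¹)^* α)`. -/
def d {k : ℕ} (α : DiffForm I M k) : DiffForm I M (k + 1) := fun x ↦
  (extDerivWithin (α.inChart x) (Set.range I) (extChartAt I x x)).compContinuousLinearMap
    (mfderiv I 𝓘(ℂ, E) (extChartAt I x) x)

/-- The pull-back of a form by a map `f : M → M`. -/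
def pullback {k : ℕ} (f : M → M) (α : DiffForm I M k) : DiffForm I M k := fun x ↦
  (α (f x)).compContinuousLinearMap (mfderiv I I f x)

/-- A (complex) symplectic form: a closed, holomorphic, everywhere non-degenerate 2-form. -/
structure IsSymplectic (σ : DiffForm I M 2) : Prop where
  holomorphic : σ.IsHolomorphic
  closed : σ.d = 0
  nondegenerate : ∀ (x : M) (u : TangentSpace I x),
    (∀ w : TangentSpace I x, σ x ![u, w] = 0) → u = 0

end DiffForm

end Forms

/-! ### Line bundles, contact forms and contactization -/

section Contact

variable {E : Type*} [NormedAddCommGroup E] [NormedSpace ℂ E]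
  {X : Type*} [TopologicalSpace X] [ChartedSpace E X]
  (L : X → Type*) [∀ x, AddCommGroup (L x)] [∀ x, Module ℂ (L x)] [∀ x, TopologicalSpace (L x)]

/-- The fibres of the dual line bundle `L*`. -/
abbrev DualLine (x : X) : Type _ := L x →L[ℂ] Bundle.Trivial X ℂ x

variable [TopologicalSpace (Bundle.TotalSpace ℂ L)] [FiberBundle ℂ L] [VectorBundle ℂ ℂ L]

/-- The total space of the dual line bundle `L*`. -/
abbrev DualTotal : Type _ := Bundle.TotalSpace (ℂ →L[ℂ] ℂ) (DualLine L)

theorem isOpen_compl_zeroSection : IsOpen {v : DualTotal L | v.2 ≠ 0} := by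
  rw [isOpen_iff_mem_nhds]
  rintro ⟨x, a⟩ ha
  let e := trivializationAt (ℂ →L[ℂ] ℂ) (DualLine L) x
  have hlin : ∀ w : DualTotal L, w.proj ∈ e.baseSet → ((e w).2 ≠ 0 ↔ w.2 ≠ 0) := by
    intro w hw
    have h : (e w).2 = e.continuousLinearEquivAt ℂ w.proj hw w.2 := rfl
    rw [h, ne_eq, ContinuousLinearEquiv.map_eq_zero_iff]
  have ho : IsOpen (e.source ∩ e ⁻¹' {z | z.2 ≠ 0}) :=
    e.continuousOn.isOpen_inter_preimage e.open_source
      (isOpen_compl_singleton.preimage continuous_snd)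
  have hx : x ∈ e.baseSet := FiberBundle.mem_baseSet_trivializationAt' x
  refine Filter.mem_of_superset (ho.mem_nhds ⟨e.mem_source.2 hx, (hlin ⟨x, a⟩ hx).2 ha⟩) ?_
  rintro w ⟨hw, hw'⟩
  exact (hlin w (e.mem_source.1 hw)).1 hw'

/-- `L^×`: the complement of the zero section in `L*`, as an open submanifold of `L*`. -/
def puncturedDual : TopologicalSpace.Opens (DualTotal L) :=
  ⟨{v | v.2 ≠ 0}, isOpen_compl_zeroSection L⟩

/-- The model with corners of the complex manifolds `L*` and `L^×`. -/
abbrev dualModel (E : Type*) [NormedAddCommGroup E] [NormedSpace ℂ E] :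
    ModelWithCorners ℂ (E × (ℂ →L[ℂ] ℂ)) (ModelProd E (ℂ →L[ℂ] ℂ)) :=
  𝓘(ℂ, E).prod 𝓘(ℂ, ℂ →L[ℂ] ℂ)

/-- The projection `p : L^× → X`. -/
def puncturedProj (v : puncturedDual L) : X := v.1.proj

/-- The action of `c ∈ ℂ^*` on `L^×` by homotheties in the fibres. -/
def homothety (c : ℂˣ) (v : puncturedDual L) : puncturedDual L :=
  ⟨⟨v.1.proj, (c : ℂ) • v.1.2⟩, smul_ne_zero c.ne_zero v.2⟩

/-- A form `σ` on `L^×` is `ℂ^*`-equivariant if `c^* σ = c σ` for all `c ∈ ℂ^*`. -/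
def IsEquivariant {k : ℕ} (σ : DiffForm (dualModel E) (puncturedDual L) k) : Prop :=
  ∀ c : ℂˣ, σ.pullback (homothety L c) = fun v ↦ (c : ℂ) • σ v

variable [∀ x, IsTopologicalAddGroup (L x)] [∀ x, ContinuousSMul ℂ (L x)]
  [IsManifold 𝓘(ℂ, E) 1 X]

variable (E) in
/-- The space `H⁰(X, Ω¹_X ⊗ L)` of holomorphic 1-forms on `X` with values in `L`, that is,
holomorphic sections of `Hom(T(X), L)`. -/
abbrev TwistedOneForm : Type _ :=
  Cₛ^ω⟮𝓘(ℂ, E); E →L[ℂ] ℂ, fun x : X ↦ TangentSpace 𝓘(ℂ, E) x →L[ℂ] L x⟯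

variable {L}

namespace TwistedOneForm

/-- The honest 1-form that `θ` becomes in a local trivialization `e` of `L`
(meaningful over the base set of `e`). -/
def inTrivialization (θ : TwistedOneForm E L)
    (e : Bundle.Trivialization ℂ (Bundle.TotalSpace.proj : Bundle.TotalSpace ℂ L → X))
    [MemTrivializationAtlas e] : DiffForm 𝓘(ℂ, E) X 1 := fun x ↦
  ContinuousAlternatingMap.ofSubsingleton ℂ (TangentSpace 𝓘(ℂ, E) x) ℂ (0 : Fin 1)
    ((e.continuousLinearMapAt ℂ x).comp (θ x))

/-- `θ : T(X) → L` is a contact structure with values in `L`: it is surjective at each point (so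
that `H = ker θ` is a subbundle of corank 1 and `T(X) / H = L`), and the 2-form `dθ`, computed near
each point in a local trivialization of `L`, restricts to a non-degenerate form on `H` at that
point. (The restriction of `dθ` to `H` changes only by a unit when the trivialization does.) -/
structure IsContact (θ : TwistedOneForm E L) : Prop where
  surjective : ∀ x : X, Function.Surjective (θ x)
  nondegenerate : ∀ (x : X) (u : TangentSpace 𝓘(ℂ, E) x), θ x u = 0 →
    (∀ w : TangentSpace 𝓘(ℂ, E) x, θ x w = 0 →
      (θ.inTrivialization (trivializationAt ℂ L x)).d x ![u, w] = 0) → u = 0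

/-- The 1-form `p^*θ` on `L^×`, by means of the canonical trivialization of `p^*L`: at a point
`(x, a)` of `L^×`, where `a : L x → ℂ` is linear and nonzero, it sends a tangent vector `w` to
`a (θ_x (dp w))`. -/
def pull (θ : TwistedOneForm E L) : DiffForm (dualModel E) (puncturedDual L) 1 := fun v ↦
  ContinuousAlternatingMap.ofSubsingleton ℂ (TangentSpace (dualModel E) v) ℂ (0 : Fin 1)
    ((v.1.2 : L v.1.proj →L[ℂ] ℂ).comp
      ((θ v.1.proj).comp (mfderiv (dualModel E) 𝓘(ℂ, E) (puncturedProj L) v)))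

end TwistedOneForm

end Contact

end

/-!
# Contact forms and symplectic forms on the punctured dual line bundle

In a chart of `X` and a trivialization of `L`, a twisted 1-form `θ` becomes an ordinary 1-form `β`
on an open set of `E` (`TwistedOneForm.localExpr`), the manifold `L^×` becomes an open set with
coordinates `(y, ζ)`, `ζ ≠ 0`, and `p^*θ` becomes `ζ β` (`TwistedOneForm.pull_inChart`). Hence
`d(p^*θ) = ζ dβ + dζ ∧ β` (`TwistedOneForm.pull_d_inChart`), because the exterior derivative of a
holomorphic form can be computed in any chart (`DiffForm.inChart_d`). Everything about `d(p^*θ)` is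
read off this formula: it has weight one in `ζ`, it is closed and holomorphic, and linear algebra
(`nondegenerate_iff_ker`) shows that it is non-degenerate over `x` exactly when `β` is nonzero at
`x` and `dβ` is non-degenerate on its kernel (`TwistedOneForm.isContact_iff`).

Conversely, let `σ` be closed, holomorphic and equivariant, and let `V = ζ ∂_ζ` be the Euler field,
which has the same expression in all charts (`chartFrame_eulerField`). Equivariance says `σ` has
weight one along the flow of `V`, so the Lie derivative of `σ` along `V` is `σ`, and Cartan's
formula gives `d(ι_V σ) = σ` (`extDeriv_curryLeft`, `lieDeriv_eq_of_homogeneous`). The 1-form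
`ι_V σ` kills the vertical vectors, since the fibres are one-dimensional and `V` is vertical, and it
has weight one (`curry_eulerField_of_homogeneous`); it is therefore `p^*θ` for a twisted 1-form `θ`
(`contractionForm`), whose local expression is `ι_V σ` along `ζ = id`. So `σ = d(p^*θ)`, and `θ` is
a contact form because `σ` is non-degenerate. It is unique, since `d(p^*θ)` evaluated on the
vertical vectors determines `θ` (`TwistedOneForm.pull_d_injective`).
-/

noncomputable section

/-! ### Charts of a complex manifold without boundary -/

section Frames

variable {E : Type*} [NormedAddCommGroup E] [NormedSpace ℂ E]
  {H : Type*} [TopologicalSpace H] {I : ModelWithCorners ℂ E H}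
  {M : Type*} [TopologicalSpace M] [ChartedSpace H M]
  {E' : Type*} [NormedAddCommGroup E'] [NormedSpace ℂ E']
  {H' : Type*} [TopologicalSpace H'] {I' : ModelWithCorners ℂ E' H'}
  {N : Type*} [TopologicalSpace N] [ChartedSpace H' N]

variable (I) in
/-- The derivative at `y` of the inverse of the chart centred at `x`. Every tangent space of `M`
is the model space `E` by definition, so this is an endomorphism of `E`. -/
def chartFrame (x : M) (y : E) : E →L[ℂ] E :=
  mfderivWithin 𝓘(ℂ, E) I (extChartAt I x).symm (Set.range I) y

/-- The chart centred at `x` is the one that identifies the tangent space at `x` with `E`. -/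
theorem chartFrame_self [IsManifold I 1 M] (x : M) :
    chartFrame I x (extChartAt I x x) = ContinuousLinearMap.id ℂ E :=
  mfderivWithin_range_extChartAt_symm

/-- A map `f` that reads `g` in the charts at `x` and `x'` acts on tangent vectors as the
derivative of `g`. -/
theorem mfderiv_chartFrame [I.Boundaryless] [I'.Boundaryless] [IsManifold I 1 M] [IsManifold I' 1 N]
    {f : M → N} {g : E → E'} {x : M} {x' : N} {y : E}
    (hy : y ∈ (extChartAt I x).target) (hgy : g y ∈ (extChartAt I' x').target)
    (hf : MDifferentiableAt I I' f ((extChartAt I x).symm y)) (hg : DifferentiableAt ℂ g y)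
    (hfg : ∀ᶠ z in 𝓝 y, f ((extChartAt I x).symm z) = (extChartAt I' x').symm (g z)) (u : E) :
    (mfderiv I I' f ((extChartAt I x).symm y) (chartFrame I x y u) : E') =
      chartFrame I' x' (g y) (fderiv ℂ g y u) := by
  have h1 : MDifferentiableAt 𝓘(ℂ, E) I (extChartAt I x).symm y := by
    rw [← mdifferentiableWithinAt_univ, ← I.range_eq_univ]
    exact mdifferentiableWithinAt_extChartAt_symm hy
  have h2 : MDifferentiableAt 𝓘(ℂ, E') I' (extChartAt I' x').symm (g y) := by
    rw [← mdifferentiableWithinAt_univ, ← I'.range_eq_univ]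
    exact mdifferentiableWithinAt_extChartAt_symm hgy
  have e1 := mfderiv_comp y hf h1
  have e2 := mfderiv_comp y h2 hg.mdifferentiableAt
  have e3 := Filter.EventuallyEq.mfderiv_eq (I := 𝓘(ℂ, E)) (I' := I') hfg
  rw [mfderiv_eq_fderiv] at e2
  unfold chartFrame
  rw [I.range_eq_univ, I'.range_eq_univ, mfderivWithin_univ, mfderivWithin_univ]
  exact (DFunLike.congr_fun e1 u).symm.trans
    ((DFunLike.congr_fun e3 u).trans (DFunLike.congr_fun e2 u))

theorem contDiffAt_transition [I.Boundaryless] [IsManifold I ω M] {x x' : M} {y : E}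
    (hy : y ∈ (extChartAt I x).target)
    (hy' : (extChartAt I x).symm y ∈ (extChartAt I x').source) :
    ContDiffAt ℂ ω (extChartAt I x' ∘ (extChartAt I x).symm) y := by
  rw [← contDiffWithinAt_univ, ← I.range_eq_univ]
  exact contDiffWithinAt_ext_coord_change x' x ⟨hy, hy'⟩

theorem eventually_symm_mem_source [I.Boundaryless] {x x' : M} {y : E}
    (hy : y ∈ (extChartAt I x).target)
    (hy' : (extChartAt I x).symm y ∈ (extChartAt I x').source) :
    ∀ᶠ z in 𝓝 y, z ∈ (extChartAt I x).target ∧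
      (extChartAt I x).symm z ∈ (extChartAt I x').source :=
  Filter.Eventually.and ((isOpen_extChartAt_target x).mem_nhds hy)
    ((continuousAt_extChartAt_symm'' hy).eventually
      ((isOpen_extChartAt_source x').mem_nhds hy'))

/-- Tangent vectors transform by the derivative of the transition map. -/
theorem chartFrame_transition [I.Boundaryless] [IsManifold I ω M] {x x' : M} {y : E}
    (hy : y ∈ (extChartAt I x).target)
    (hy' : (extChartAt I x).symm y ∈ (extChartAt I x').source) (u : E) :
    chartFrame I x' (extChartAt I x' ((extChartAt I x).symm y))
      (fderiv ℂ (extChartAt I x' ∘ (extChartAt I x).symm) y u) = chartFrame I x y u := by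
  have := mfderiv_chartFrame (I := I) (I' := I) (f := id)
    (g := extChartAt I x' ∘ (extChartAt I x).symm) hy ((extChartAt I x').map_source hy')
    mdifferentiableAt_id ((contDiffAt_transition hy hy').differentiableAt (by simp))
    (by
      filter_upwards [eventually_symm_mem_source hy hy'] with z hz
      exact ((extChartAt I x').left_inv hz.2).symm) u
  rw [mfderiv_id] at this
  exact this.symm

/-- The derivative of the transition map to the chart centred at the point itself. -/
theorem fderiv_transition_self [I.Boundaryless] [IsManifold I ω M] {x : M} {y : E}
    (hy : y ∈ (extChartAt I x).target) :
    fderiv ℂ (extChartAt I ((extChartAt I x).symm y) ∘ (extChartAt I x).symm) y =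
      chartFrame I x y := by
  ext u
  have := chartFrame_transition hy (mem_extChartAt_source ((extChartAt I x).symm y)) u
  rwa [chartFrame_self] at this

end Frames

/-! ### Differential forms in charts -/

namespace DiffForm

section General

variable {E : Type*} [NormedAddCommGroup E] [NormedSpace ℂ E]
  {H : Type*} [TopologicalSpace H] {I : ModelWithCorners ℂ E H}
  {M : Type*} [TopologicalSpace M] [ChartedSpace H M] {k : ℕ}

theorem inChart_apply (α : DiffForm I M k) (x : M) (y : E) (w : Fin k → E) :
    α.inChart x y w = α ((extChartAt I x).symm y) (fun i ↦ chartFrame I x y (w i)) := rfl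

/-- Transport of the value of a form along an equality of points; the tangent spaces at the two
points are both `E` by definition. -/
theorem congr_point (α : DiffForm I M k) {x x' : M} (h : x = x') (w : Fin k → E) :
    α x (w : Fin k → TangentSpace I x) = α x' (w : Fin k → TangentSpace I x') := by
  subst h; rfl

/-- At the centre of a chart, the expression of a form is the form itself: the tangent space
at `x` is by definition identified with the model space by means of the chart at `x`. -/
theorem inChart_self [IsManifold I 1 M] (α : DiffForm I M k) (x : M) (w : Fin k → E) :
    α.inChart x (extChartAt I x x) w = α x (w : Fin k → TangentSpace I x) := by
  rw [inChart_apply, chartFrame_self]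
  exact congr_point α (extChartAt_to_inv (I := I) x) w

theorem ext_inChart [IsManifold I 1 M] {α β : DiffForm I M k}
    (h : ∀ (x : M) (w : Fin k → E), α.inChart x (extChartAt I x x) w =
      β.inChart x (extChartAt I x x) w) : α = β := by
  funext x
  ext w
  exact (inChart_self α x w).symm.trans ((h x w).trans (inChart_self β x w))

variable [I.Boundaryless]

theorem d_apply [IsManifold I 1 M] (α : DiffForm I M k) (x : M) (w : Fin (k + 1) → E) :
    α.d x (w : Fin (k + 1) → TangentSpace I x) =
      extDeriv (α.inChart x) (extChartAt I x x) w := by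
  rw [← extDerivWithin_univ, ← I.range_eq_univ]
  change extDerivWithin (α.inChart x) (Set.range I) (extChartAt I x x)
    (fun i ↦ mfderiv I 𝓘(ℂ, E) (extChartAt I x) x (w i)) = _
  rw [mfderiv_extChartAt_self]
  rfl

/-- The expressions of a form in two charts are related by the transition map. -/
theorem inChart_transition [IsManifold I ω M] (α : DiffForm I M k) {x x' : M} {y : E}
    (hy : y ∈ (extChartAt I x).target)
    (hy' : (extChartAt I x).symm y ∈ (extChartAt I x').source) :
    α.inChart x y =
      (α.inChart x' ((extChartAt I x' ∘ (extChartAt I x).symm) y)).compContinuousLinearMap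
        (fderiv ℂ (extChartAt I x' ∘ (extChartAt I x).symm) y) := by
  ext w
  rw [ContinuousAlternatingMap.compContinuousLinearMap_apply, inChart_apply, inChart_apply]
  simp only [Function.comp_apply, chartFrame_transition hy hy']
  exact congr_point α ((extChartAt I x').left_inv hy').symm _

theorem IsHolomorphic.contDiffAt {α : DiffForm I M k} (hα : α.IsHolomorphic) {x : M} {y : E}
    (hy : y ∈ (extChartAt I x).target) : ContDiffAt ℂ ω (α.inChart x) y :=
  (hα x).contDiffAt ((isOpen_extChartAt_target x).mem_nhds hy)

/-- The exterior derivative can be computed in any chart. -/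
theorem inChart_d [IsManifold I ω M] {α : DiffForm I M k} (hα : α.IsHolomorphic) {x : M} {y : E}
    (hy : y ∈ (extChartAt I x).target) :
    α.d.inChart x y = extDeriv (α.inChart x) y := by
  -- `α.d` at the point of coordinates `y` is computed in the chart centred at that point.
  set x' := (extChartAt I x).symm y with hx'
  have hs : (extChartAt I x).symm y ∈ (extChartAt I x').source := mem_extChartAt_source x'
  have h1 : α.inChart x =ᶠ[𝓝 y] fun z ↦
      (α.inChart x' ((extChartAt I x' ∘ (extChartAt I x).symm) z)).compContinuousLinearMap
        (fderiv ℂ (extChartAt I x' ∘ (extChartAt I x).symm) z) := by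
    filter_upwards [eventually_symm_mem_source hy hs] with z hz
    exact inChart_transition α hz.1 hz.2
  rw [h1.extDeriv_eq, extDeriv_pullback (r := ω) (f := extChartAt I x' ∘ (extChartAt I x).symm)
    ((hα.contDiffAt ((extChartAt I x').map_source hs)).differentiableAt (by simp))
    (contDiffAt_transition hy hs) (by simp)]
  ext w
  rw [inChart_apply, ContinuousAlternatingMap.compContinuousLinearMap_apply,
    fderiv_transition_self hy]
  exact d_apply α x' _

set_option synthInstance.maxHeartbeats 200000 in
theorem IsHolomorphic.d [IsManifold I ω M] {α : DiffForm I M k} (hα : α.IsHolomorphic) :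
    α.d.IsHolomorphic := fun x ↦ by
  refine ContDiffOn.congr ?_ fun y hy ↦ inChart_d hα hy
  have h := (hα x).fderiv_of_isOpen (isOpen_extChartAt_target x) (m := ω) (by simp)
  exact (ContinuousAlternatingMap.alternatizeUncurryFinCLM ℂ E ℂ).contDiff.comp_contDiffOn h

theorem IsHolomorphic.d_d [IsManifold I ω M] {α : DiffForm I M k} (hα : α.IsHolomorphic) :
    α.d.d = 0 := by
  funext x
  ext w
  have hx := mem_extChartAt_target (I := I) x
  have h : α.d.inChart x =ᶠ[𝓝 (extChartAt I x x)] extDeriv (α.inChart x) := by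
    filter_upwards [(isOpen_extChartAt_target x).mem_nhds hx] with y hy using inChart_d hα hy
  refine (d_apply α.d x w).trans ?_
  rw [h.extDeriv_eq, extDeriv_extDeriv_apply (hα.contDiffAt hx) (by simp)]
  rfl

end General
end DiffForm

/-! ### Homogeneous forms on a vector space -/

section Cartan

theorem update_pair_zero {W : Type*} (a b c : W) : Function.update ![a, b] 0 c = ![c, b] := by
  ext i; fin_cases i <;> rfl

theorem update_pair_one {W : Type*} (a b c : W) : Function.update ![a, b] 1 c = ![a, c] := by
  ext i; fin_cases i <;> rfl

variable {V : Type*} [NormedAddCommGroup V] [NormedSpace ℂ V]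

theorem extDeriv_one_form_apply {a : V → V [⋀^Fin 1]→L[ℂ] ℂ} {p : V}
    (ha : DifferentiableAt ℂ a p) (w w' : V) :
    extDeriv a p ![w, w'] =
      fderiv ℂ (fun q ↦ a q ![w']) p w - fderiv ℂ (fun q ↦ a q ![w]) p w' := by
  rw [extDeriv_apply ha, Fin.sum_univ_two]
  have h0 : (0 : Fin 2).removeNth ![w, w'] = ![w'] := by ext i; fin_cases i; rfl
  have h1 : (1 : Fin 2).removeNth ![w, w'] = ![w] := by ext i; fin_cases i; rfl
  simp only [h0, h1]
  simp [sub_eq_add_neg]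

theorem extDeriv_two_form_apply {S : V → V [⋀^Fin 2]→L[ℂ] ℂ} {p : V}
    (hS : DifferentiableAt ℂ S p) (u w w' : V) :
    extDeriv S p ![u, w, w'] =
      fderiv ℂ S p u ![w, w'] - fderiv ℂ S p w ![u, w'] + fderiv ℂ S p w' ![u, w] := by
  rw [extDeriv_apply hS, Fin.sum_univ_three]
  have h0 : (0 : Fin 3).removeNth ![u, w, w'] = ![w, w'] := by ext i; fin_cases i <;> rfl
  have h1 : (1 : Fin 3).removeNth ![u, w, w'] = ![u, w'] := by ext i; fin_cases i <;> rfl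
  have h2 : (2 : Fin 3).removeNth ![u, w, w'] = ![u, w] := by ext i; fin_cases i <;> rfl
  simp only [h0, h1, h2, fderiv_continuousAlternatingMap_apply_const_apply hS]
  simp [sub_eq_add_neg]

set_option synthInstance.maxHeartbeats 200000 in
theorem ContDiffAt.curryLeft_apply {S : V → V [⋀^Fin 2]→L[ℂ] ℂ} {p : V}
    (hS : ContDiffAt ℂ ω S p) (X : V →L[ℂ] V) :
    ContDiffAt ℂ ω (fun q ↦ (S q).curryLeft (X q)) p := by
  have h1 : ContDiff ℂ ω (ContinuousAlternatingMap.curryLeftLI (𝕜 := ℂ) (E := V) (F := ℂ)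
    (n := 1)) := LinearIsometry.contDiff _
  exact (h1.contDiffAt.comp p hS).clm_apply X.contDiff.contDiffAt

theorem map_pair_swap (A : V [⋀^Fin 2]→L[ℂ] ℂ) (a b : V) : A ![a, b] = - A ![b, a] := by
  refine Eq.trans ?_ (A.map_swap ![b, a] (i := 0) (j := 1) (by decide))
  change _ = A _
  congr 1; ext i; fin_cases i <;> rfl

/-- Cartan's formula for a closed 2-form and a linear vector field. -/
theorem extDeriv_curryLeft {S : V → V [⋀^Fin 2]→L[ℂ] ℂ} {p : V} (hS : ContDiffAt ℂ ω S p)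
    (hd : extDeriv S p = 0) (X : V →L[ℂ] V) (w w' : V) :
    extDeriv (fun q ↦ (S q).curryLeft (X q)) p ![w, w'] =
      fderiv ℂ S p (X p) ![w, w'] + S p ![X w, w'] + S p ![w, X w'] := by
  have hS' : DifferentiableAt ℂ S p := hS.differentiableAt (by simp)
  have h0 : extDeriv S p ![X p, w, w'] = 0 := by rw [hd]; rfl
  rw [extDeriv_two_form_apply hS'] at h0
  have key : ∀ v u, fderiv ℂ (fun q ↦ (S q).curryLeft (X q) ![v]) p u =
      fderiv ℂ S p u ![X p, v] + S p ![X u, v] := by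
    intro v u
    have hg : ∀ i : Fin 2, DifferentiableAt ℂ (fun q ↦ (![X q, v] : Fin 2 → V) i) p := by
      intro i
      fin_cases i
      · exact X.differentiableAt
      · exact differentiableAt_const v
    have h := fderiv_continuousAlternatingMap_apply_apply hS' hg u
    rw [Fin.sum_univ_two] at h
    have e0 : fderiv ℂ (fun q ↦ (![X q, v] : Fin 2 → V) 0) p u = X u :=
      congrArg (· u) X.fderiv
    have e1 : fderiv ℂ (fun q ↦ (![X q, v] : Fin 2 → V) 1) p u = 0 := by
      have : fderiv ℂ (fun _ : V ↦ v) p = 0 := (hasFDerivAt_const v p).fderiv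
      exact congrArg (· u) this
    rw [e0, e1, update_pair_zero, update_pair_one] at h
    have e2 : S p ![X p, 0] = 0 := (S p).map_coord_zero 1 rfl
    rw [e2, add_zero] at h
    exact h
  rw [extDeriv_one_form_apply ((hS.curryLeft_apply X).differentiableAt (by simp)), key, key,
    map_pair_swap _ (X w') w]
  linear_combination -h0

theorem hasDerivAt_flow (X : V →L[ℂ] V) (v : V) :
    HasDerivAt (fun c : ℂ ↦ v + (c - 1) • X v) (X v) 1 := by
  simpa using! (((hasDerivAt_id (1 : ℂ)).sub_const 1).smul_const (X v)).const_add v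

/-- A 2-form of weight one under the flow `id + (c - 1) X` equals its Lie derivative
along `X`. -/
theorem lieDeriv_eq_of_homogeneous {S : V → V [⋀^Fin 2]→L[ℂ] ℂ} {p : V}
    (hS : DifferentiableAt ℂ S p) (X : V →L[ℂ] V) {w w' : V}
    (hom : ∀ᶠ c in 𝓝 (1 : ℂ), S (p + (c - 1) • X p) ![w + (c - 1) • X w, w' + (c - 1) • X w'] =
      c * S p ![w, w']) :
    fderiv ℂ S p (X p) ![w, w'] + S p ![X w, w'] + S p ![w, X w'] = S p ![w, w'] := by
  have hS' : HasFDerivAt S (fderiv ℂ S p) (p + ((1 : ℂ) - 1) • X p) := by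
    simpa using hS.hasFDerivAt
  have hc : HasDerivAt (fun c : ℂ ↦ S (p + (c - 1) • X p)) (fderiv ℂ S p (X p)) 1 :=
    hS'.comp_hasDerivAt (1 : ℂ) (hasDerivAt_flow X p)
  have hg : ∀ i : Fin 2, HasFDerivAt
      (fun c : ℂ ↦ (![w + (c - 1) • X w, w' + (c - 1) • X w'] : Fin 2 → V) i)
      (ContinuousLinearMap.toSpanSingleton ℂ ((![X w, X w'] : Fin 2 → V) i)) 1 := by
    intro i
    fin_cases i
    · exact (hasDerivAt_flow X w).hasFDerivAt
    · exact (hasDerivAt_flow X w').hasFDerivAt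
  have hL := (hc.hasFDerivAt.continuousAlternatingMap_apply hg).hasDerivAt
  have hR : HasDerivAt (fun c : ℂ ↦ c * S p ![w, w']) (S p ![w, w']) 1 := by
    simpa using (hasDerivAt_id (1 : ℂ)).mul_const (S p ![w, w'])
  have := hL.unique (hR.congr_of_eventuallyEq hom)
  rw [← this, add_apply, sum_apply, Fin.sum_univ_two,
    add_assoc]
  have key : (fun i ↦ (![w + ((1 : ℂ) - 1) • X w, w' + ((1 : ℂ) - 1) • X w'] : Fin 2 → V) i) =
      ![w, w'] := by
    ext i; fin_cases i <;> simp
  simp only [ContinuousLinearMap.comp_apply, key]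
  simp [ContinuousAlternatingMap.toContinuousLinearMap_apply, update_pair_zero,
    update_pair_one]

end Cartan

/-! ### Forms on the product of a vector space with a dual line -/

section Product

variable {E : Type*} [NormedAddCommGroup E] [NormedSpace ℂ E]

/-- The exterior derivative of the tautological multiple `(y, ζ) ↦ ζ • β y` of a 1-form `β`,
that is, `d(ζ β) = ζ dβ + dζ ∧ β`. -/
theorem extDeriv_tautological {β : E → E [⋀^Fin 1]→L[ℂ] ℂ}
    {a : E × (ℂ →L[ℂ] ℂ) → (E × (ℂ →L[ℂ] ℂ)) [⋀^Fin 1]→L[ℂ] ℂ} {p : E × (ℂ →L[ℂ] ℂ)}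
    (hβ : DifferentiableAt ℂ β p.1) (ha : DifferentiableAt ℂ a p)
    (hab : ∀ᶠ q in 𝓝 p, ∀ w : E × (ℂ →L[ℂ] ℂ), a q ![w] = q.2 (β q.1 ![w.1]))
    (w w' : E × (ℂ →L[ℂ] ℂ)) :
    extDeriv a p ![w, w'] =
      p.2 (extDeriv β p.1 ![w.1, w'.1]) + w.2 (β p.1 ![w'.1]) - w'.2 (β p.1 ![w.1]) := by
  have key : ∀ v : E × (ℂ →L[ℂ] ℂ), ∀ u, fderiv ℂ (fun q ↦ a q ![v]) p u =
      p.2 (fderiv ℂ β p.1 u.1 ![v.1]) + u.2 (β p.1 ![v.1]) := by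
    intro v u
    have h1 : (fun q ↦ a q ![v]) =ᶠ[𝓝 p] fun q ↦ q.2 (β q.1 ![v.1]) := by
      filter_upwards [hab] with q hq using hq v
    have h2 : HasFDerivAt (fun q : E × (ℂ →L[ℂ] ℂ) ↦ β q.1 ![v.1]) _ p :=
      (hβ.hasFDerivAt.continuousAlternatingMap_apply_const ![v.1]).comp p hasFDerivAt_fst
    rw [h1.fderiv_eq, (hasFDerivAt_snd.clm_apply h2).fderiv]
    rfl
  rw [extDeriv_one_form_apply ha, key, key, extDeriv_one_form_apply hβ,
    fderiv_continuousAlternatingMap_apply_const_apply hβ,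
    fderiv_continuousAlternatingMap_apply_const_apply hβ, map_sub]
  ring

theorem complex_clm_apply (t : ℂ →L[ℂ] ℂ) (c : ℂ) : t c = c * t 1 := by
  have := t.map_smul c 1
  simpa using this

/-- The form `ζ A + dζ ∧ B` at `ζ ≠ 0` is non-degenerate if and only if `B` is nonzero and `A` is
non-degenerate on the kernel of `B`. -/
theorem nondegenerate_iff_ker {S : (E × (ℂ →L[ℂ] ℂ)) [⋀^Fin 2]→L[ℂ] ℂ}
    {A : E [⋀^Fin 2]→L[ℂ] ℂ} {B : E [⋀^Fin 1]→L[ℂ] ℂ} {ζ : ℂ →L[ℂ] ℂ} (hζ : ζ ≠ 0)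
    (hS : ∀ w w', S ![w, w'] = ζ (A ![w.1, w'.1]) + w.2 (B ![w'.1]) - w'.2 (B ![w.1])) :
    (∀ w, (∀ w', S ![w, w'] = 0) → w = 0) ↔
      (∃ e, B ![e] ≠ 0) ∧ ∀ u, B ![u] = 0 → (∀ u', B ![u'] = 0 → A ![u, u'] = 0) → u = 0 := by
  have hζ1 : ζ 1 ≠ 0 := fun h ↦ hζ (by ext; simpa using h)
  have B0 : B ![0] = 0 := B.map_coord_zero 0 rfl
  have Badd : ∀ u u', B ![u + u'] = B ![u] + B ![u'] := fun u u' ↦ B.vecCons_add ![] u u'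
  have Bsmul : ∀ (c : ℂ) u, B ![c • u] = c * B ![u] := fun c u ↦ B.vecCons_smul ![] c u
  constructor
  · intro h
    have hB : ∃ e, B ![e] ≠ 0 := by
      by_contra! hB
      have := h (0, ContinuousLinearMap.id ℂ ℂ) fun w' ↦ by
        rw [hS]
        have : A ![0, w'.1] = 0 := A.map_coord_zero 0 rfl
        simp [this, hB]
      simpa using congrArg (fun w : E × (ℂ →L[ℂ] ℂ) ↦ w.2 1) this
    refine ⟨hB, ?_⟩
    intro u hu hA
    obtain ⟨e, he⟩ := hB
    -- On the whole space `A u` is a multiple `c` of `B`, so `(u, -c ζ)` lies in the kernel of `S`.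
    set c := A ![u, e] / B ![e] with hc
    have hAB : ∀ u', A ![u, u'] = c * B ![u'] := by
      intro u'
      have h1 := hA (u' + (-(B ![u'] / B ![e])) • e) (by rw [Badd, Bsmul]; field_simp; ring)
      have h2 := (A.curryLeft u).vecCons_add ![] u' ((-(B ![u'] / B ![e])) • e)
      have h3 := (A.curryLeft u).vecCons_smul ![] (-(B ![u'] / B ![e])) e
      have e1 : ∀ b : E, (A.curryLeft u) ![b] = A ![u, b] := fun b ↦ rfl
      rw [e1, e1, e1] at h2
      rw [e1, e1, smul_eq_mul] at h3
      rw [h1, h3] at h2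
      rw [hc]
      field_simp at h2 ⊢
      linear_combination -h2
    have := h (u, -c • ζ) fun w' ↦ by
      rw [hS]
      simp only [hu, map_zero, hAB]
      rw [← smul_eq_mul, map_smul]
      simp
    exact congrArg Prod.fst this
  · rintro ⟨⟨e, he⟩, hA⟩ ⟨u, t⟩ h
    have hu : B ![u] = 0 := by
      have := h (0, ContinuousLinearMap.id ℂ ℂ)
      rw [hS] at this
      have h0 : A ![u, 0] = 0 := A.map_coord_zero 1 rfl
      simpa [h0, B0] using this
    have hu0 : u = 0 := hA u hu fun u' hu' ↦ by
      have := h (u', 0)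
      rw [hS] at this
      simp only [hu', map_zero, hu, sub_zero, add_zero] at this
      rw [complex_clm_apply] at this
      exact (mul_eq_zero.1 this).resolve_right hζ1
    subst hu0
    have ht : t = 0 := by
      have := h (e, 0)
      rw [hS] at this
      have h0 : A ![0, e] = 0 := A.map_coord_zero 0 rfl
      simp only [h0, map_zero, hu, sub_zero, zero_add] at this
      rw [complex_clm_apply] at this
      ext
      simpa using (mul_eq_zero.1 this).resolve_left he
    rw [ht]; rfl

end Product

/-! ### Charts of the punctured dual bundle -/

section Charts

variable {E : Type*} [NormedAddCommGroup E] [NormedSpace ℂ E]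
  {X : Type*} [TopologicalSpace X] [ChartedSpace E X]
  {L : X → Type*} [∀ x, AddCommGroup (L x)] [∀ x, Module ℂ (L x)] [∀ x, TopologicalSpace (L x)]
  [TopologicalSpace (Bundle.TotalSpace ℂ L)] [FiberBundle ℂ L] [VectorBundle ℂ ℂ L]

theorem trivializationAt_dual_apply (x : X) (v : DualTotal L) :
    trivializationAt (ℂ →L[ℂ] ℂ) (DualLine L) x v =
      (v.proj, (v.2 : L v.proj →L[ℂ] ℂ) ∘L (trivializationAt ℂ L x).symmL ℂ v.proj) := by
  rw [hom_trivializationAt_apply]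
  unfold ContinuousLinearMap.inCoordinates
  have : (trivializationAt ℂ (Bundle.Trivial X ℂ) x).continuousLinearMapAt ℂ v.proj =
    ContinuousLinearMap.id ℂ ℂ := Bundle.Trivial.continuousLinearMapAt_trivialization ℂ X ℂ v.proj
  rw [this]
  rfl

theorem mem_dual_chart_source {v w : puncturedDual L} :
    w ∈ (extChartAt (dualModel E) v).source ↔
      w.1.proj ∈ (extChartAt 𝓘(ℂ, E) v.1.proj).source ∧
        w.1.proj ∈ (trivializationAt ℂ L v.1.proj).baseSet := by
  have h1 : (extChartAt (dualModel E) v).source =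
      Subtype.val ⁻¹' (extChartAt (dualModel E) v.1).source := by
    rw [extChartAt_source, extChartAt_source, TopologicalSpace.Opens.chartAt_eq,
      OpenPartialHomeomorph.subtypeRestr_source]
  have h2 : (trivializationAt (ℂ →L[ℂ] ℂ) (DualLine L) v.1.proj).baseSet =
      (trivializationAt ℂ L v.1.proj).baseSet := by
    rw [hom_trivializationAt_baseSet]
    exact Set.inter_eq_left.2 fun _ _ ↦ trivial
  rw [h1, Set.mem_preimage, FiberBundle.extChartAt, PartialEquiv.trans_source, Set.mem_inter_iff,
    Set.mem_preimage, PartialEquiv.prod_source, Set.mem_prod]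
  change w.1 ∈ (trivializationAt (ℂ →L[ℂ] ℂ) (DualLine L) v.1.proj).source ∧
    (trivializationAt (ℂ →L[ℂ] ℂ) (DualLine L) v.1.proj w.1).1 ∈ _ ∧ True ↔ _
  rw [Bundle.Trivialization.mem_source, h2, trivializationAt_dual_apply]
  tauto

theorem dual_chart_apply (v w : puncturedDual L) :
    extChartAt (dualModel E) v w = (extChartAt 𝓘(ℂ, E) v.1.proj w.1.proj,
      (w.1.2 : L w.1.proj →L[ℂ] ℂ) ∘L (trivializationAt ℂ L v.1.proj).symmL ℂ w.1.proj) := by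
  have h : extChartAt (dualModel E) v w = extChartAt (dualModel E) v.1 w.1 := rfl
  rw [h, FiberBundle.extChartAt]
  change (extChartAt 𝓘(ℂ, E) v.1.proj
    (trivializationAt (ℂ →L[ℂ] ℂ) (DualLine L) v.1.proj w.1).1,
      (trivializationAt (ℂ →L[ℂ] ℂ) (DualLine L) v.1.proj w.1).2) = _
  rw [trivializationAt_dual_apply]

theorem mem_dual_chart_target {v : puncturedDual L} {p : E × (ℂ →L[ℂ] ℂ)} :
    p ∈ (extChartAt (dualModel E) v).target ↔
      p.1 ∈ (extChartAt 𝓘(ℂ, E) v.1.proj).target ∧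
        (extChartAt 𝓘(ℂ, E) v.1.proj).symm p.1 ∈ (trivializationAt ℂ L v.1.proj).baseSet ∧
          p.2 ≠ 0 := by
  constructor
  · intro hp
    obtain ⟨hs, hb⟩ := mem_dual_chart_source.1 ((extChartAt (dualModel E) v).map_target hp)
    have h := dual_chart_apply (E := E) v ((extChartAt (dualModel E) v).symm p)
    rw [(extChartAt (dualModel E) v).right_inv hp] at h
    set w := (extChartAt (dualModel E) v).symm p
    have h1 : p.1 = _ := congrArg Prod.fst h
    have h2 : p.2 = _ := congrArg Prod.snd h
    refine ⟨h1 ▸ (extChartAt 𝓘(ℂ, E) v.1.proj).map_source hs, ?_, ?_⟩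
    · rwa [h1, (extChartAt 𝓘(ℂ, E) v.1.proj).left_inv hs]
    · rw [h2]
      intro h0
      apply w.2
      ext ℓ
      have := DFunLike.congr_fun h0
        ((trivializationAt ℂ L v.1.proj).continuousLinearMapAt ℂ w.1.proj ℓ)
      rwa [ContinuousLinearMap.comp_apply,
        Bundle.Trivialization.symmL_continuousLinearMapAt _ hb] at this
  · rintro ⟨ht, hb, h0⟩
    set x := (extChartAt 𝓘(ℂ, E) v.1.proj).symm p.1 with hx
    let a : L x →L[ℂ] ℂ := p.2 ∘L (trivializationAt ℂ L v.1.proj).continuousLinearMapAt ℂ x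
    have ha : a ∘L (trivializationAt ℂ L v.1.proj).symmL ℂ x = p.2 := by
      ext
      simp only [a, ContinuousLinearMap.comp_apply]
      rw [Bundle.Trivialization.continuousLinearMapAt_symmL _ hb]
    let w : puncturedDual L := ⟨⟨x, a⟩, fun h ↦ h0 (by
      have : a = 0 := h
      rw [← ha, this, ContinuousLinearMap.zero_comp])⟩
    have hw : w ∈ (extChartAt (dualModel E) v).source :=
      mem_dual_chart_source.2 ⟨(extChartAt 𝓘(ℂ, E) v.1.proj).map_target ht, hb⟩
    have h := (extChartAt (dualModel E) v).map_source hw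
    rw [dual_chart_apply] at h
    change (extChartAt 𝓘(ℂ, E) v.1.proj x, a ∘L _) ∈ _ at h
    rwa [ha, (extChartAt 𝓘(ℂ, E) v.1.proj).right_inv ht] at h

theorem dual_chart_symm_proj {v : puncturedDual L} {p : E × (ℂ →L[ℂ] ℂ)}
    (hp : p ∈ (extChartAt (dualModel E) v).target) :
    ((extChartAt (dualModel E) v).symm p).1.proj =
      (extChartAt 𝓘(ℂ, E) v.1.proj).symm p.1 := by
  have h := dual_chart_apply (E := E) v ((extChartAt (dualModel E) v).symm p)
  rw [(extChartAt (dualModel E) v).right_inv hp] at h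
  have hs := (mem_dual_chart_source.1 ((extChartAt (dualModel E) v).map_target hp)).1
  rw [h, (extChartAt 𝓘(ℂ, E) v.1.proj).left_inv hs, ← h]

theorem dual_chart_symm_apply {v : puncturedDual L} {p : E × (ℂ →L[ℂ] ℂ)}
    (hp : p ∈ (extChartAt (dualModel E) v).target)
    (ℓ : L ((extChartAt (dualModel E) v).symm p).1.proj) :
    (((extChartAt (dualModel E) v).symm p).1.2 :
      L ((extChartAt (dualModel E) v).symm p).1.proj →L[ℂ] ℂ) ℓ =
        p.2 ((trivializationAt ℂ L v.1.proj).continuousLinearMapAt ℂ _ ℓ) := by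
  have h := dual_chart_apply (E := E) v ((extChartAt (dualModel E) v).symm p)
  rw [(extChartAt (dualModel E) v).right_inv hp] at h
  have hb := (mem_dual_chart_source.1 ((extChartAt (dualModel E) v).map_target hp)).2
  have h2 := DFunLike.congr_fun (congrArg Prod.snd h)
    ((trivializationAt ℂ L v.1.proj).continuousLinearMapAt ℂ _ ℓ)
  rw [h2, ContinuousLinearMap.comp_apply,
    Bundle.Trivialization.symmL_continuousLinearMapAt _ hb]

theorem smul_mem_dual_chart_target {v : puncturedDual L} {p : E × (ℂ →L[ℂ] ℂ)}
    (hp : p ∈ (extChartAt (dualModel E) v).target) {c : ℂ} (hc : c ≠ 0) :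
    (p.1, c • p.2) ∈ (extChartAt (dualModel E) v).target := by
  rw [mem_dual_chart_target] at hp ⊢
  exact ⟨hp.1, hp.2.1, smul_ne_zero hc hp.2.2⟩

theorem homothety_mem_dual_chart_source {v w : puncturedDual L} (c : ℂˣ)
    (hw : w ∈ (extChartAt (dualModel E) v).source) :
    homothety L c w ∈ (extChartAt (dualModel E) v).source :=
  mem_dual_chart_source.2 (mem_dual_chart_source.1 hw)

theorem dual_chart_homothety (v w : puncturedDual L) (c : ℂˣ) :
    extChartAt (dualModel E) v (homothety L c w) =
      ((extChartAt (dualModel E) v w).1, (c : ℂ) • (extChartAt (dualModel E) v w).2) := by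
  rw [dual_chart_apply, dual_chart_apply]
  rfl

theorem homothety_dual_chart_symm {v : puncturedDual L} {p : E × (ℂ →L[ℂ] ℂ)}
    (hp : p ∈ (extChartAt (dualModel E) v).target) (c : ℂˣ) :
    homothety L c ((extChartAt (dualModel E) v).symm p) =
      (extChartAt (dualModel E) v).symm (p.1, (c : ℂ) • p.2) := by
  have hs := homothety_mem_dual_chart_source c ((extChartAt (dualModel E) v).map_target hp)
  rw [← (extChartAt (dualModel E) v).left_inv hs, dual_chart_homothety,
    (extChartAt (dualModel E) v).right_inv hp]

/-- The linear vector field `(u, t) ↦ (0, t)`: the generator of the homotheties in charts. -/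
def eulerField (E : Type*) [NormedAddCommGroup E] [NormedSpace ℂ E] :
    E × (ℂ →L[ℂ] ℂ) →L[ℂ] E × (ℂ →L[ℂ] ℂ) :=
  ContinuousLinearMap.inr ℂ E (ℂ →L[ℂ] ℂ) ∘L ContinuousLinearMap.snd ℂ E (ℂ →L[ℂ] ℂ)

theorem eulerField_apply (p : E × (ℂ →L[ℂ] ℂ)) : eulerField E p = (0, p.2) := rfl

/-- The homothety of ratio `c`, read in a chart. -/
def fibreScaling (E : Type*) [NormedAddCommGroup E] [NormedSpace ℂ E] (c : ℂ) :
    E × (ℂ →L[ℂ] ℂ) →L[ℂ] E × (ℂ →L[ℂ] ℂ) :=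
  (ContinuousLinearMap.fst ℂ E (ℂ →L[ℂ] ℂ)).prod (c • ContinuousLinearMap.snd ℂ E (ℂ →L[ℂ] ℂ))

theorem fibreScaling_apply (c : ℂ) (p : E × (ℂ →L[ℂ] ℂ)) :
    fibreScaling E c p = (p.1, c • p.2) := rfl

theorem fibreScaling_eq (c : ℂ) (p : E × (ℂ →L[ℂ] ℂ)) :
    fibreScaling E c p = p + (c - 1) • eulerField E p := by
  rw [fibreScaling_apply, eulerField_apply]
  ext
  · simp
  · simp
    ring

theorem mdifferentiable_puncturedProj :
    MDifferentiable (dualModel E) 𝓘(ℂ, E) (puncturedProj L) := by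
  have h : ContMDiff (dualModel E) 𝓘(ℂ, E) 1 (puncturedProj L) :=
    (Bundle.contMDiff_proj (DualLine L)).comp contMDiff_subtype_val
  exact h.mdifferentiable (by simp)

variable [IsManifold 𝓘(ℂ, E) ω X] [ContMDiffVectorBundle ω ℂ L 𝓘(ℂ, E)]

theorem mfderiv_puncturedProj {v : puncturedDual L} {p : E × (ℂ →L[ℂ] ℂ)}
    (hp : p ∈ (extChartAt (dualModel E) v).target) (w : E × (ℂ →L[ℂ] ℂ)) :
    (mfderiv (dualModel E) 𝓘(ℂ, E) (puncturedProj L) ((extChartAt (dualModel E) v).symm p)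
      (chartFrame (dualModel E) v p w) : E) = chartFrame 𝓘(ℂ, E) v.1.proj p.1 w.1 := by
  have h := mfderiv_chartFrame (I := dualModel E) (I' := 𝓘(ℂ, E)) (f := puncturedProj L)
    (g := Prod.fst) (x' := v.1.proj) hp (mem_dual_chart_target.1 hp).1
    (mdifferentiable_puncturedProj _) differentiableAt_fst
    (by
      filter_upwards [(isOpen_extChartAt_target v).mem_nhds hp] with q hq
      exact dual_chart_symm_proj hq) w
  rw [h, fderiv_fst]
  rfl

theorem mdifferentiable_homothety (c : ℂˣ) :
    MDifferentiable (dualModel E) (dualModel E) (homothety L c) := by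
  intro v
  have h1 : MDifferentiableAt (dualModel E) 𝓘(ℂ, E × (ℂ →L[ℂ] ℂ)) (extChartAt (dualModel E) v) v :=
    mdifferentiableAt_extChartAt (mem_chart_source _ v)
  have h2 : MDifferentiableAt 𝓘(ℂ, E × (ℂ →L[ℂ] ℂ)) 𝓘(ℂ, E × (ℂ →L[ℂ] ℂ)) (fibreScaling E c)
      (extChartAt (dualModel E) v v) := (fibreScaling E c).differentiableAt.mdifferentiableAt
  have ht : fibreScaling E c (extChartAt (dualModel E) v v) ∈ (extChartAt (dualModel E) v).target :=
    smul_mem_dual_chart_target (mem_extChartAt_target v) c.ne_zero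
  have h3 : MDifferentiableAt 𝓘(ℂ, E × (ℂ →L[ℂ] ℂ)) (dualModel E) (extChartAt (dualModel E) v).symm
      (fibreScaling E c (extChartAt (dualModel E) v v)) := by
    rw [← mdifferentiableWithinAt_univ, ← (dualModel E).range_eq_univ]
    exact mdifferentiableWithinAt_extChartAt_symm ht
  refine (h3.comp v (h2.comp v h1)).congr_of_eventuallyEq ?_
  filter_upwards [extChartAt_source_mem_nhds (I := dualModel E) v] with w hw
  have hs := homothety_mem_dual_chart_source c hw
  rw [← (extChartAt (dualModel E) v).left_inv hs, dual_chart_homothety]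
  rfl

theorem mfderiv_homothety {v : puncturedDual L} {p : E × (ℂ →L[ℂ] ℂ)}
    (hp : p ∈ (extChartAt (dualModel E) v).target) (c : ℂˣ) (w : E × (ℂ →L[ℂ] ℂ)) :
    (mfderiv (dualModel E) (dualModel E) (homothety L c) ((extChartAt (dualModel E) v).symm p)
      (chartFrame (dualModel E) v p w) : E × (ℂ →L[ℂ] ℂ)) =
        chartFrame (dualModel E) v (fibreScaling E c p) (fibreScaling E c w) := by
  have h := mfderiv_chartFrame (I := dualModel E) (I' := dualModel E) (f := homothety L c)
    (g := fibreScaling E c) (x' := v) hp (smul_mem_dual_chart_target hp c.ne_zero)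
    (mdifferentiable_homothety c _) (fibreScaling E c).differentiableAt
    (by
      filter_upwards [(isOpen_extChartAt_target v).mem_nhds hp] with q hq
      exact homothety_dual_chart_symm hq c) w
  rw [h, ContinuousLinearMap.fderiv]

/-- Equivariance of a form, read in charts. -/
theorem isEquivariant_iff_inChart {k : ℕ} (σ : DiffForm (dualModel E) (puncturedDual L) k) :
    IsEquivariant L σ ↔ ∀ (v : puncturedDual L) (p : E × (ℂ →L[ℂ] ℂ)),
      p ∈ (extChartAt (dualModel E) v).target → ∀ (c : ℂ), c ≠ 0 →
        ∀ w : Fin k → E × (ℂ →L[ℂ] ℂ),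
        σ.inChart v (fibreScaling E c p) (fun i ↦ fibreScaling E c (w i)) =
          c * σ.inChart v p w := by
  have key : ∀ (v : puncturedDual L) (p : E × (ℂ →L[ℂ] ℂ)),
      p ∈ (extChartAt (dualModel E) v).target → ∀ (c : ℂˣ) (w : Fin k → E × (ℂ →L[ℂ] ℂ)),
      (σ.pullback (homothety L c)).inChart v p w =
        σ.inChart v (fibreScaling E c p) (fun i ↦ fibreScaling E c (w i)) := by
    intro v p hp c w
    rw [DiffForm.inChart_apply, DiffForm.inChart_apply]
    simp only [← mfderiv_homothety hp]
    exact DiffForm.congr_point σ (homothety_dual_chart_symm hp c) _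
  constructor
  · intro h v p hp c hc w
    have := key v p hp (Units.mk0 c hc) w
    rw [h] at this
    exact this.symm
  · intro h c
    refine DiffForm.ext_inChart fun v w ↦ ?_
    have hp := mem_extChartAt_target (I := dualModel E) v
    rw [key v _ hp, h v _ hp _ c.ne_zero]
    rfl

end Charts

/-! ### Twisted 1-forms in charts -/

section Twisted

variable {E : Type*} [NormedAddCommGroup E] [NormedSpace ℂ E]
  {X : Type*} [TopologicalSpace X] [ChartedSpace E X]
  {L : X → Type*} [∀ x, AddCommGroup (L x)] [∀ x, Module ℂ (L x)] [∀ x, TopologicalSpace (L x)]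
  [TopologicalSpace (Bundle.TotalSpace ℂ L)] [FiberBundle ℂ L] [VectorBundle ℂ ℂ L]

/-- The expression of a family of linear maps `T x : T_x X → L x` in the chart of `X` and the
trivialization of `L` centred at `x₀`. It is meaningful at the `y` in the target of the chart whose
point of `X` lies in the base set of the trivialization. -/
def localForm (T : ∀ x : X, TangentSpace 𝓘(ℂ, E) x →L[ℂ] L x) (x₀ : X) (y : E) : E →L[ℂ] ℂ :=
  (trivializationAt ℂ L x₀).continuousLinearMapAt ℂ ((extChartAt 𝓘(ℂ, E) x₀).symm y) ∘L
    (show E →L[ℂ] L ((extChartAt 𝓘(ℂ, E) x₀).symm y) from T ((extChartAt 𝓘(ℂ, E) x₀).symm y)) ∘L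
      chartFrame 𝓘(ℂ, E) x₀ y

theorem localForm_apply (T : ∀ x : X, TangentSpace 𝓘(ℂ, E) x →L[ℂ] L x) (x₀ : X) (y u : E) :
    localForm T x₀ y u =
      (trivializationAt ℂ L x₀).continuousLinearMapAt ℂ ((extChartAt 𝓘(ℂ, E) x₀).symm y)
        (T ((extChartAt 𝓘(ℂ, E) x₀).symm y) (chartFrame 𝓘(ℂ, E) x₀ y u)) := rfl

/-- Transport of the value of `T` along an equality of points. -/
theorem twisted_congr_point (T : ∀ x : X, TangentSpace 𝓘(ℂ, E) x →L[ℂ] L x)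
    (e : Bundle.Trivialization ℂ (Bundle.TotalSpace.proj : Bundle.TotalSpace ℂ L → X))
    [MemTrivializationAtlas e] {x x' : X} (h : x = x') (u : E) :
    e.continuousLinearMapAt ℂ x (T x (u : TangentSpace 𝓘(ℂ, E) x)) =
      e.continuousLinearMapAt ℂ x' (T x' (u : TangentSpace 𝓘(ℂ, E) x')) := by
  subst h; rfl

theorem localForm_self [IsManifold 𝓘(ℂ, E) 1 X] (T : ∀ x : X, TangentSpace 𝓘(ℂ, E) x →L[ℂ] L x)
    (x : X) (u : E) :
    localForm T x (extChartAt 𝓘(ℂ, E) x x) u =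
      (trivializationAt ℂ L x).continuousLinearMapAt ℂ x (T x (u : TangentSpace 𝓘(ℂ, E) x)) := by
  rw [localForm_apply, chartFrame_self]
  exact twisted_congr_point T _ (extChartAt_to_inv x) u

section

variable [IsManifold 𝓘(ℂ, E) ω X] [∀ x, IsTopologicalAddGroup (L x)]
  [∀ x, ContinuousSMul ℂ (L x)]

/-- The local expression of `θ` near `x₀` as a 1-form on the model space. -/
def TwistedOneForm.localExpr (θ : TwistedOneForm E L) (x₀ : X) : E → E [⋀^Fin 1]→L[ℂ] ℂ :=
  (θ.inTrivialization (trivializationAt ℂ L x₀)).inChart x₀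

theorem TwistedOneForm.localExpr_apply (θ : TwistedOneForm E L) (x₀ : X) (y u : E) :
    θ.localExpr x₀ y ![u] = localForm θ x₀ y u := rfl

end

variable [IsManifold 𝓘(ℂ, E) ω X] [ContMDiffVectorBundle ω ℂ L 𝓘(ℂ, E)]

/-- The 1-form `(x, a) ↦ a ∘ T x ∘ dp` on `L^×`, read in a chart. -/
theorem dual_apply_mfderiv_proj (T : ∀ x : X, TangentSpace 𝓘(ℂ, E) x →L[ℂ] L x)
    {v : puncturedDual L} {p : E × (ℂ →L[ℂ] ℂ)}
    (hp : p ∈ (extChartAt (dualModel E) v).target) (w : E × (ℂ →L[ℂ] ℂ)) :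
    (((extChartAt (dualModel E) v).symm p).1.2 :
      L ((extChartAt (dualModel E) v).symm p).1.proj →L[ℂ] ℂ)
        (T ((extChartAt (dualModel E) v).symm p).1.proj
          (mfderiv (dualModel E) 𝓘(ℂ, E) (puncturedProj L) ((extChartAt (dualModel E) v).symm p)
            (chartFrame (dualModel E) v p w))) =
      p.2 (localForm T v.1.proj p.1 w.1) := by
  rw [localForm_apply, ← mfderiv_puncturedProj hp w]
  refine (dual_chart_symm_apply hp _).trans ?_
  congr 1
  exact twisted_congr_point T _ (dual_chart_symm_proj hp) _

variable [∀ x, IsTopologicalAddGroup (L x)] [∀ x, ContinuousSMul ℂ (L x)]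

/-- A family of linear maps `T_x X → L x` is holomorphic near a point if and only if its local
expression is. -/
theorem contMDiffAt_iff_localForm (T : ∀ x : X, TangentSpace 𝓘(ℂ, E) x →L[ℂ] L x) {x₀ x : X}
    (hx : x ∈ (extChartAt 𝓘(ℂ, E) x₀).source) (hb : x ∈ (trivializationAt ℂ L x₀).baseSet) :
    ContMDiffAt 𝓘(ℂ, E) (𝓘(ℂ, E).prod 𝓘(ℂ, E →L[ℂ] ℂ)) ω
        (fun x ↦ Bundle.TotalSpace.mk' (E →L[ℂ] ℂ)
          (E := fun x : X ↦ TangentSpace 𝓘(ℂ, E) x →L[ℂ] L x) x (T x)) x ↔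
      ContDiffAt ℂ ω (localForm T x₀) (extChartAt 𝓘(ℂ, E) x₀ x) := by
  have : IsManifold 𝓘(ℂ, E) (ω + 1) X := inferInstanceAs (IsManifold 𝓘(ℂ, E) ω X)
  have : ContMDiffVectorBundle ω E (TangentSpace 𝓘(ℂ, E) : X → Type _) 𝓘(ℂ, E) :=
    TangentBundle.contMDiffVectorBundle
  have hx' : x ∈ (chartAt E x₀).source := by rwa [extChartAt_source] at hx
  rw [Bundle.Trivialization.contMDiffAt_section_iff
    (trivializationAt (E →L[ℂ] ℂ) (fun x : X ↦ TangentSpace 𝓘(ℂ, E) x →L[ℂ] L x) x₀)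
    (by rw [hom_trivializationAt_baseSet]; exact ⟨hx', hb⟩)]
  have hU : ∀ᶠ z in 𝓝 x, z ∈ (extChartAt 𝓘(ℂ, E) x₀).source :=
    (isOpen_extChartAt_source x₀).mem_nhds hx
  have heq : (fun z ↦ (trivializationAt (E →L[ℂ] ℂ)
      (fun x : X ↦ TangentSpace 𝓘(ℂ, E) x →L[ℂ] L x) x₀ ⟨z, T z⟩).2) =ᶠ[𝓝 x]
      localForm T x₀ ∘ extChartAt 𝓘(ℂ, E) x₀ := by
    filter_upwards [hU] with z hz
    rw [hom_trivializationAt_apply]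
    unfold ContinuousLinearMap.inCoordinates
    rw [TangentBundle.symmL_trivializationAt (by rwa [extChartAt_source] at hz)]
    ext u
    exact (twisted_congr_point T (trivializationAt ℂ L x₀)
      ((extChartAt 𝓘(ℂ, E) x₀).left_inv hz) _).symm
  rw [heq.contMDiffAt_iff]
  have ht := (extChartAt 𝓘(ℂ, E) x₀).map_source hx
  constructor
  · intro h
    rw [← contMDiffAt_iff_contDiffAt]
    have h1 : ContMDiffAt 𝓘(ℂ, E) 𝓘(ℂ, E) ω (extChartAt 𝓘(ℂ, E) x₀).symm
        (extChartAt 𝓘(ℂ, E) x₀ x) :=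
      (contMDiffOn_extChartAt_symm x₀).contMDiffAt ((isOpen_extChartAt_target x₀).mem_nhds ht)
    have h2 := ContMDiffAt.comp_of_eq h h1 ((extChartAt 𝓘(ℂ, E) x₀).left_inv hx)
    refine h2.congr_of_eventuallyEq ?_
    filter_upwards [(isOpen_extChartAt_target x₀).mem_nhds ht] with y hy
    simp only [Function.comp_apply, (extChartAt 𝓘(ℂ, E) x₀).right_inv hy]
  · intro h
    exact h.contMDiffAt.comp x (contMDiffAt_extChartAt' hx')

/-- Linear forms as alternating forms of degree one. -/
def oneFormEquiv (V : Type*) [NormedAddCommGroup V] [NormedSpace ℂ V] :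
    (V →L[ℂ] ℂ) ≃ₗᵢ[ℂ] (V [⋀^Fin 1]→L[ℂ] ℂ) :=
  ContinuousAlternatingMap.ofSubsingletonLIE (𝕜 := ℂ) (E := V) (F := ℂ) (0 : Fin 1)

theorem oneFormEquiv_apply {V : Type*} [NormedAddCommGroup V] [NormedSpace ℂ V] (f : V →L[ℂ] ℂ)
    (w : V) : oneFormEquiv V f ![w] = f w := rfl

theorem oneForm_ext {V : Type*} [NormedAddCommGroup V] [NormedSpace ℂ V]
    {α β : V [⋀^Fin 1]→L[ℂ] ℂ} (h : ∀ w, α ![w] = β ![w]) : α = β := by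
  ext w
  have hw : w = ![w 0] := by funext i; fin_cases i; rfl
  rw [hw]
  exact h _

namespace TwistedOneForm

theorem contDiffAt_localExpr (θ : TwistedOneForm E L) {x₀ : X} {y : E}
    (hy : y ∈ (extChartAt 𝓘(ℂ, E) x₀).target)
    (hb : (extChartAt 𝓘(ℂ, E) x₀).symm y ∈ (trivializationAt ℂ L x₀).baseSet) :
    ContDiffAt ℂ ω (θ.localExpr x₀) y := by
  have h := (contMDiffAt_iff_localForm θ ((extChartAt 𝓘(ℂ, E) x₀).map_target hy) hb).1
    (θ.contMDiff _)
  rw [(extChartAt 𝓘(ℂ, E) x₀).right_inv hy] at h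
  exact (oneFormEquiv E).contDiff.contDiffAt.comp y h

theorem pull_inChart (θ : TwistedOneForm E L) {v : puncturedDual L} {p : E × (ℂ →L[ℂ] ℂ)}
    (hp : p ∈ (extChartAt (dualModel E) v).target) (w : E × (ℂ →L[ℂ] ℂ)) :
    θ.pull.inChart v p ![w] = p.2 (θ.localExpr v.1.proj p.1 ![w.1]) :=
  dual_apply_mfderiv_proj θ hp w

theorem contDiffAt_pull_inChart (θ : TwistedOneForm E L) {v : puncturedDual L}
    {p : E × (ℂ →L[ℂ] ℂ)} (hp : p ∈ (extChartAt (dualModel E) v).target) :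
    ContDiffAt ℂ ω (θ.pull.inChart v) p := by
  obtain ⟨ht, hb, -⟩ := mem_dual_chart_target.1 hp
  have h := (contMDiffAt_iff_localForm θ ((extChartAt 𝓘(ℂ, E) v.1.proj).map_target ht) hb).1
    (θ.contMDiff _)
  rw [(extChartAt 𝓘(ℂ, E) v.1.proj).right_inv ht] at h
  have h1 : ContDiffAt ℂ ω (fun q : E × (ℂ →L[ℂ] ℂ) ↦
      (q.2 ∘L localForm θ v.1.proj q.1) ∘L ContinuousLinearMap.fst ℂ E (ℂ →L[ℂ] ℂ)) p :=
    (contDiffAt_snd.clm_comp (ContDiffAt.comp p h contDiffAt_fst)).clm_comp contDiffAt_const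
  refine ((oneFormEquiv _).contDiff.contDiffAt.comp p h1).congr_of_eventuallyEq ?_
  filter_upwards [(isOpen_extChartAt_target v).mem_nhds hp] with q hq
  exact oneForm_ext fun w ↦ pull_inChart θ hq w

theorem isHolomorphic_pull (θ : TwistedOneForm E L) : θ.pull.IsHolomorphic := fun _ _ hp ↦
  (contDiffAt_pull_inChart θ hp).contDiffWithinAt

/-- In a chart, `d(p^*θ) = ζ dβ + dζ ∧ β`, where `β` is the local expression of `θ`. -/
theorem pull_d_inChart (θ : TwistedOneForm E L) {v : puncturedDual L} {p : E × (ℂ →L[ℂ] ℂ)}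
    (hp : p ∈ (extChartAt (dualModel E) v).target) (w w' : E × (ℂ →L[ℂ] ℂ)) :
    θ.pull.d.inChart v p ![w, w'] =
      p.2 (extDeriv (θ.localExpr v.1.proj) p.1 ![w.1, w'.1]) +
        w.2 (θ.localExpr v.1.proj p.1 ![w'.1]) - w'.2 (θ.localExpr v.1.proj p.1 ![w.1]) := by
  obtain ⟨ht, hb, -⟩ := mem_dual_chart_target.1 hp
  rw [DiffForm.inChart_d θ.isHolomorphic_pull hp]
  refine extDeriv_tautological ((θ.contDiffAt_localExpr ht hb).differentiableAt (by simp))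
    ((θ.contDiffAt_pull_inChart hp).differentiableAt (by simp)) ?_ w w'
  filter_upwards [(isOpen_extChartAt_target v).mem_nhds hp] with q hq w
  exact pull_inChart θ hq w

theorem isEquivariant_pull_d (θ : TwistedOneForm E L) : IsEquivariant L θ.pull.d := by
  rw [isEquivariant_iff_inChart]
  intro v p hp c hc w
  have hw : w = ![w 0, w 1] := by funext i; fin_cases i <;> rfl
  have hw' : (fun i ↦ fibreScaling E c (w i)) =
      ![fibreScaling E c (w 0), fibreScaling E c (w 1)] := by funext i; fin_cases i <;> rfl
  have hcp : fibreScaling E c p ∈ (extChartAt (dualModel E) v).target :=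
    smul_mem_dual_chart_target hp hc
  rw [hw', pull_d_inChart θ hcp, hw, pull_d_inChart θ hp]
  simp only [fibreScaling_apply, smul_apply, smul_eq_mul, Matrix.cons_val_zero,
    Matrix.cons_val_one]
  ring

end TwistedOneForm

variable (L) in
/-- The point of `L^×` over `x` given by the trivialization of `L` centred at `x`. -/
def unitPoint (x : X) : puncturedDual L :=
  ⟨⟨x, (trivializationAt ℂ L x).continuousLinearMapAt ℂ x⟩, fun h ↦ by
    have h1 := DFunLike.congr_fun (show (trivializationAt ℂ L x).continuousLinearMapAt ℂ x = 0
      from h) ((trivializationAt ℂ L x).symmL ℂ x 1)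
    rw [Bundle.Trivialization.continuousLinearMapAt_symmL _
      (FiberBundle.mem_baseSet_trivializationAt' x)] at h1
    exact one_ne_zero h1⟩

namespace TwistedOneForm

/-- Non-degeneracy of `d(p^*θ)` at a single point of `L^×` over `x` is the contact condition for
`θ` at `x`. -/
theorem nondegenerate_pull_d_iff (θ : TwistedOneForm E L) (v : puncturedDual L) :
    (∀ u : TangentSpace (dualModel E) v,
      (∀ w : TangentSpace (dualModel E) v, θ.pull.d v ![u, w] = 0) → u = 0) ↔
    Function.Surjective (θ v.1.proj) ∧
      ∀ u : TangentSpace 𝓘(ℂ, E) v.1.proj, θ v.1.proj u = 0 →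
        (∀ w : TangentSpace 𝓘(ℂ, E) v.1.proj, θ v.1.proj w = 0 →
          (θ.inTrivialization (trivializationAt ℂ L v.1.proj)).d v.1.proj ![u, w] = 0) →
            u = 0 := by
  set x := v.1.proj with hx
  have hb : x ∈ (trivializationAt ℂ L x).baseSet := FiberBundle.mem_baseSet_trivializationAt' x
  have hp := mem_extChartAt_target (I := dualModel E) v
  have hζ := (mem_dual_chart_target.1 hp).2.2
  have hp1 : (extChartAt (dualModel E) v v).1 = extChartAt 𝓘(ℂ, E) x x := by
    rw [dual_chart_apply]
  have key := nondegenerate_iff_ker hζ fun w w' ↦ pull_d_inChart θ hp w w'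
  rw [hp1, ← hx] at key
  have hS : ∀ u w : E × (ℂ →L[ℂ] ℂ),
      θ.pull.d.inChart v (extChartAt (dualModel E) v v) ![u, w] = θ.pull.d v ![u, w] :=
    fun u w ↦ DiffForm.inChart_self _ v ![u, w]
  have hA : ∀ u w : E, extDeriv (θ.localExpr x) (extChartAt 𝓘(ℂ, E) x x) ![u, w] =
      (θ.inTrivialization (trivializationAt ℂ L x)).d x ![u, w] :=
    fun u w ↦ (DiffForm.d_apply _ x ![u, w]).symm
  have hB : ∀ u : E, θ.localExpr x (extChartAt 𝓘(ℂ, E) x x) ![u] =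
      (trivializationAt ℂ L x).continuousLinearMapAt ℂ x (θ x u) :=
    fun u ↦ (localExpr_apply θ x _ u).trans (localForm_self θ x u)
  have hinj : ∀ ℓ : L x, (trivializationAt ℂ L x).continuousLinearMapAt ℂ x ℓ = 0 ↔ ℓ = 0 := by
    intro ℓ
    refine ⟨fun h ↦ ?_, fun h ↦ by rw [h, map_zero]⟩
    rw [← (trivializationAt ℂ L x).symmL_continuousLinearMapAt (R := ℂ) hb ℓ, h, map_zero]
  simp only [hS, hA, hB, hinj] at key
  refine Iff.trans key (and_congr_left' ?_)
  constructor
  · rintro ⟨e, he⟩ ℓ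
    let e : TangentSpace 𝓘(ℂ, E) x := e
    set c := (trivializationAt ℂ L x).continuousLinearMapAt ℂ x (θ x e) with hc
    refine ⟨((trivializationAt ℂ L x).continuousLinearMapAt ℂ x ℓ / c) • e, ?_⟩
    rw [← sub_eq_zero, ← hinj, map_sub, map_smul, map_smul, ← hc, smul_eq_mul,
      div_mul_cancel₀ _ he, sub_self]
  · intro h
    obtain ⟨e, he⟩ := h ((trivializationAt ℂ L x).symmL ℂ x 1)
    refine ⟨e, fun h0 ↦ ?_⟩
    rw [he] at h0
    have h1 := (trivializationAt ℂ L x).continuousLinearMapAt_symmL (R := ℂ) hb (1 : ℂ)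
    exact zero_ne_one (h0.symm.trans h1)

/-- A twisted 1-form `θ` is a contact form if and only if `d(p^*θ)` is non-degenerate. -/
theorem isContact_iff (θ : TwistedOneForm E L) :
    θ.IsContact ↔ ∀ (v : puncturedDual L) (u : TangentSpace (dualModel E) v),
      (∀ w : TangentSpace (dualModel E) v, θ.pull.d v ![u, w] = 0) → u = 0 := by
  constructor
  · exact fun h v ↦ (nondegenerate_pull_d_iff θ v).2 ⟨h.surjective _, h.nondegenerate _⟩
  · exact fun h ↦ ⟨fun x ↦ ((nondegenerate_pull_d_iff θ (unitPoint L x)).1 (h _)).1,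
      fun x ↦ ((nondegenerate_pull_d_iff θ (unitPoint L x)).1 (h _)).2⟩

theorem isSymplectic_pull_d {θ : TwistedOneForm E L} (hθ : θ.IsContact) :
    θ.pull.d.IsSymplectic where
  holomorphic := θ.isHolomorphic_pull.d
  closed := θ.isHolomorphic_pull.d_d
  nondegenerate := θ.isContact_iff.1 hθ

end TwistedOneForm

end Twisted

/-! ### Contraction of an equivariant 2-form with the Euler field -/

section Contraction

variable {E : Type*} [NormedAddCommGroup E] [NormedSpace ℂ E]
  {X : Type*} [TopologicalSpace X] [ChartedSpace E X]
  {L : X → Type*} [∀ x, AddCommGroup (L x)] [∀ x, Module ℂ (L x)] [∀ x, TopologicalSpace (L x)]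
  [TopologicalSpace (Bundle.TotalSpace ℂ L)] [FiberBundle ℂ L] [VectorBundle ℂ ℂ L]

set_option synthInstance.maxHeartbeats 200000 in
theorem ContDiffAt.interior_linear {V : Type*} [NormedAddCommGroup V] [NormedSpace ℂ V]
    {S : V → V [⋀^Fin 2]→L[ℂ] ℂ} {p : V} (hS : ContDiffAt ℂ ω S p) (X : V →L[ℂ] V) :
    ContDiffAt ℂ ω (fun q ↦ (oneFormEquiv V).symm ((S q).curryLeft (X q))) p :=
  (oneFormEquiv V).symm.contDiff.contDiffAt.comp p (hS.curryLeft_apply X)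

theorem DiffForm.inChart_congr_chart {V : Type*} [NormedAddCommGroup V] [NormedSpace ℂ V]
    {H : Type*} [TopologicalSpace H] {I : ModelWithCorners ℂ V H} {M : Type*} [TopologicalSpace M]
    [ChartedSpace H M] {k : ℕ} (α : DiffForm I M k) {x x' : M}
    (h : extChartAt I x = extChartAt I x') : α.inChart x = α.inChart x' := by
  have key : ∀ f g : PartialEquiv M V, f = g →
      (fun y ↦ (α (f.symm y)).compContinuousLinearMap
        (mfderivWithin 𝓘(ℂ, V) I f.symm (Set.range I) y)) =
      (fun y ↦ (α (g.symm y)).compContinuousLinearMap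
        (mfderivWithin 𝓘(ℂ, V) I g.symm (Set.range I) y)) := by
    rintro f _ rfl; rfl
  exact key _ _ h

/-- The chart of `L^×` centred at a point depends only on the base point. -/
theorem dual_chart_eq_unitPoint (v : puncturedDual L) :
    extChartAt (dualModel E) v = extChartAt (dualModel E) (unitPoint L v.1.proj) := by
  have h : chartAt (ModelProd E (ℂ →L[ℂ] ℂ)) v.1 =
      chartAt (ModelProd E (ℂ →L[ℂ] ℂ)) (unitPoint L v.1.proj).1 := by
    rw [FiberBundle.chartedSpace_chartAt, FiberBundle.chartedSpace_chartAt]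
    rfl
  simp only [extChartAt, TopologicalSpace.Opens.chartAt_eq, h]

theorem unit_mem_dual_chart_target {v : puncturedDual L} {p : E × (ℂ →L[ℂ] ℂ)}
    (hp : p ∈ (extChartAt (dualModel E) v).target) :
    (p.1, ContinuousLinearMap.id ℂ ℂ) ∈ (extChartAt (dualModel E) v).target := by
  rw [mem_dual_chart_target] at hp ⊢
  refine ⟨hp.1, hp.2.1, fun h ↦ ?_⟩
  simpa using DFunLike.congr_fun h (1 : ℂ)

/-- The linear map `T_x X → L x` obtained by contracting `σ` with the Euler field at the point
`unitPoint L x` of the fibre over `x`. A tangent vector of `X` is lifted to the horizontal vector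
`(u, 0)` of the chart, and a value in `ℂ` is carried to `L x` by the trivialization centred at
`x`. -/
def contraction (σ : DiffForm (dualModel E) (puncturedDual L) 2) (x : X) :
    TangentSpace 𝓘(ℂ, E) x →L[ℂ] L x :=
  (trivializationAt ℂ L x).symmL ℂ x ∘L
    (show E →L[ℂ] ℂ from (oneFormEquiv _).symm
      ((σ.inChart (unitPoint L x) (extChartAt 𝓘(ℂ, E) x x, ContinuousLinearMap.id ℂ ℂ)).curryLeft
        (0, ContinuousLinearMap.id ℂ ℂ)) ∘L ContinuousLinearMap.inl ℂ E (ℂ →L[ℂ] ℂ))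

theorem contraction_apply (σ : DiffForm (dualModel E) (puncturedDual L) 2) (x : X) (u : E) :
    contraction σ x (u : TangentSpace 𝓘(ℂ, E) x) = (trivializationAt ℂ L x).symmL ℂ x
      (σ.inChart (unitPoint L x) (extChartAt 𝓘(ℂ, E) x x, ContinuousLinearMap.id ℂ ℂ)
        ![(0, ContinuousLinearMap.id ℂ ℂ), (u, 0)]) := by
  change (trivializationAt ℂ L x).symmL ℂ x ((oneFormEquiv _).symm
    ((σ.inChart (unitPoint L x) (extChartAt 𝓘(ℂ, E) x x, ContinuousLinearMap.id ℂ ℂ)).curryLeft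
        (0, ContinuousLinearMap.id ℂ ℂ)) (u, 0)) = _
  rw [← oneFormEquiv_apply ((oneFormEquiv _).symm _), LinearIsometryEquiv.apply_symm_apply]
  rfl

variable [IsManifold 𝓘(ℂ, E) ω X] [ContMDiffVectorBundle ω ℂ L 𝓘(ℂ, E)]

/-- The Euler field has the same expression in all charts. -/
theorem chartFrame_eulerField {v : puncturedDual L} {p : E × (ℂ →L[ℂ] ℂ)}
    (hp : p ∈ (extChartAt (dualModel E) v).target) :
    chartFrame (dualModel E) v p (eulerField E p) =
      eulerField E (extChartAt (dualModel E) ((extChartAt (dualModel E) v).symm p)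
        ((extChartAt (dualModel E) v).symm p)) := by
  -- The transition map to the chart centred at `v'` commutes with the homotheties; differentiate
  -- this at ratio one.
  set v' := (extChartAt (dualModel E) v).symm p with hv'
  set τ := extChartAt (dualModel E) v' ∘ (extChartAt (dualModel E) v).symm with hτ
  have hd : HasFDerivAt τ (chartFrame (dualModel E) v p) (p + ((1 : ℂ) - 1) • eulerField E p) := by
    rw [show p + ((1 : ℂ) - 1) • eulerField E p = p by ext <;> simp, ← fderiv_transition_self hp]
    exact ((contDiffAt_transition hp (mem_extChartAt_source v')).differentiableAt
      (by simp)).hasFDerivAt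
  have h1 := hd.comp_hasDerivAt (1 : ℂ) (hasDerivAt_flow (eulerField E) p)
  have h2 := hasDerivAt_flow (eulerField E) (extChartAt (dualModel E) v' v')
  refine h1.unique (h2.congr_of_eventuallyEq ?_)
  filter_upwards [isOpen_compl_singleton.mem_nhds (one_ne_zero : (1 : ℂ) ≠ 0)] with c hc
  have h3 := homothety_dual_chart_symm hp (Units.mk0 c hc)
  have h4 := dual_chart_homothety (E := E) v' v' (Units.mk0 c hc)
  rw [hv', h3] at h4
  simp only [Function.comp_apply, ← fibreScaling_eq, hτ]
  exact h4

/-- The interior product of a homogeneous 2-form with the Euler field kills the vertical vectors,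
which are multiples of the Euler field, and has weight one. -/
theorem curry_eulerField_of_homogeneous {S : E × (ℂ →L[ℂ] ℂ) → (E × (ℂ →L[ℂ] ℂ)) [⋀^Fin 2]→L[ℂ] ℂ}
    {p : E × (ℂ →L[ℂ] ℂ)} (hp : p.2 ≠ 0)
    (hS : ∀ c : ℂ, c ≠ 0 → ∀ w w', S (fibreScaling E c (p.1, ContinuousLinearMap.id ℂ ℂ))
      ![fibreScaling E c w, fibreScaling E c w'] =
        c * S (p.1, ContinuousLinearMap.id ℂ ℂ) ![w, w']) (w : E × (ℂ →L[ℂ] ℂ)) :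
    S p ![eulerField E p, w] = p.2 (S (p.1, ContinuousLinearMap.id ℂ ℂ)
      ![(0, ContinuousLinearMap.id ℂ ℂ), (w.1, 0)]) := by
  obtain ⟨y, ζ⟩ := p
  obtain ⟨u, t⟩ := w
  have hid : ∀ s : ℂ →L[ℂ] ℂ, s = s 1 • ContinuousLinearMap.id ℂ ℂ := fun s ↦ by ext; simp
  have hc : ζ 1 ≠ 0 := fun h ↦ hp (by
    change ζ = 0
    ext
    simpa using h)
  set e : E × (ℂ →L[ℂ] ℂ) := (0, ContinuousLinearMap.id ℂ ℂ) with he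
  -- The homothety of ratio `ζ 1` sends the point `(y, id)` to `(y, ζ)`, the vertical vector `e` to
  -- the Euler field at `(y, ζ)`, and `(u, 0) + s e` to `(u, t)`.
  set s := (ζ 1)⁻¹ * t 1 with hs
  have h1 := hS (ζ 1) hc e ((u, 0) + s • e)
  have e1 : fibreScaling E (ζ 1) (y, ContinuousLinearMap.id ℂ ℂ) = (y, ζ) := by
    rw [fibreScaling_apply, ← hid]
  have e2 : fibreScaling E (ζ 1) e = eulerField E (y, ζ) := by
    rw [fibreScaling_apply, eulerField_apply, ← hid]
  have e3 : fibreScaling E (ζ 1) ((u, 0) + s • e) = (u, t) := by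
    rw [fibreScaling_apply]
    refine Prod.ext ?_ ?_
    · simp [he]
    · simp only [he, Prod.snd_add, Prod.smul_snd, zero_add, smul_smul, hs]
      rw [mul_inv_cancel_left₀ hc, ← hid]
  rw [e1, e2, e3] at h1
  have h2 : S (y, ContinuousLinearMap.id ℂ ℂ) ![e, (u, 0) + s • e] =
      S (y, ContinuousLinearMap.id ℂ ℂ) ![e, (u, 0)] := by
    have a1 := ((S (y, ContinuousLinearMap.id ℂ ℂ)).curryLeft e).vecCons_add ![] (u, 0) (s • e)
    have a2 := ((S (y, ContinuousLinearMap.id ℂ ℂ)).curryLeft e).vecCons_smul ![] s e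
    have a3 : S (y, ContinuousLinearMap.id ℂ ℂ) ![e, e] = 0 :=
      (S (y, ContinuousLinearMap.id ℂ ℂ)).map_eq_zero_of_eq ![e, e] (i := 0) (j := 1) rfl
        (by decide)
    have a4 : ∀ b, (S (y, ContinuousLinearMap.id ℂ ℂ)).curryLeft e ![b] =
      S (y, ContinuousLinearMap.id ℂ ℂ) ![e, b] := fun b ↦ rfl
    rw [a4, a4, a4] at a1
    rw [a4, a4, a3, smul_zero] at a2
    rw [a1, a2, add_zero]
  rw [h1, h2]
  exact (mul_comm _ _).trans (complex_clm_apply ζ _).symm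

theorem inChart_pair_of_isEquivariant {σ : DiffForm (dualModel E) (puncturedDual L) 2}
    (hσ : IsEquivariant L σ) {v : puncturedDual L}
    {p : E × (ℂ →L[ℂ] ℂ)} (hp : p ∈ (extChartAt (dualModel E) v).target) {c : ℂ} (hc : c ≠ 0)
    (w w' : E × (ℂ →L[ℂ] ℂ)) :
    σ.inChart v (fibreScaling E c p) ![fibreScaling E c w, fibreScaling E c w'] =
      c * σ.inChart v p ![w, w'] := by
  rw [← (isEquivariant_iff_inChart σ).1 hσ v p hp c hc]
  congr 1
  funext i
  fin_cases i <;> rfl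

variable {σ : DiffForm (dualModel E) (puncturedDual L) 2}

/-- The 1-form on `L^×` defined by the contraction of `σ` is the interior product of `σ` with the
Euler field, at the centre of a chart. -/
theorem contraction_center (hσ : IsEquivariant L σ) (v : puncturedDual L)
    (w : E × (ℂ →L[ℂ] ℂ)) :
    (v.1.2 : L v.1.proj →L[ℂ] ℂ) (contraction σ v.1.proj
      (mfderiv (dualModel E) 𝓘(ℂ, E) (puncturedProj L) v w)) =
        σ v ![eulerField E (extChartAt (dualModel E) v v), w] := by
  have hp := mem_extChartAt_target (I := dualModel E) v
  set p := extChartAt (dualModel E) v v with hpv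
  have h1 : (mfderiv (dualModel E) 𝓘(ℂ, E) (puncturedProj L) v w : E) = w.1 := by
    have h := mfderiv_puncturedProj hp w
    have hp1 : p.1 = extChartAt 𝓘(ℂ, E) v.1.proj v.1.proj := by rw [hpv, dual_chart_apply]
    rw [hpv, chartFrame_self, ← hpv, hp1, chartFrame_self] at h
    have key : ∀ v' : puncturedDual L, v' = v →
        (mfderiv (dualModel E) 𝓘(ℂ, E) (puncturedProj L) v' w : E) =
          mfderiv (dualModel E) 𝓘(ℂ, E) (puncturedProj L) v w := by
      rintro _ rfl; rfl
    exact (key _ (extChartAt_to_inv v)).symm.trans h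
  have h2 : p = (extChartAt 𝓘(ℂ, E) v.1.proj v.1.proj,
    (v.1.2 : L v.1.proj →L[ℂ] ℂ) ∘L (trivializationAt ℂ L v.1.proj).symmL ℂ v.1.proj) :=
    dual_chart_apply v v
  have h3 := curry_eulerField_of_homogeneous (S := σ.inChart v) (mem_dual_chart_target.1 hp).2.2
    (fun c hc w w' ↦ inChart_pair_of_isEquivariant hσ (unit_mem_dual_chart_target hp) hc w w') w
  refine Eq.trans ?_ ((h3.symm.trans (DiffForm.inChart_self σ v ![eulerField E p, w])))
  rw [DiffForm.inChart_congr_chart σ (dual_chart_eq_unitPoint v), h2]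
  refine (congrArg (v.1.2 : L v.1.proj →L[ℂ] ℂ)
    ((congrArg (contraction σ v.1.proj) h1).trans (contraction_apply σ _ _)))

/-- In any chart, the 1-form defined by the contraction of `σ` is the interior product of `σ` with
the Euler field. -/
theorem localForm_contraction (hσ : IsEquivariant L σ) {v : puncturedDual L}
    {p : E × (ℂ →L[ℂ] ℂ)} (hp : p ∈ (extChartAt (dualModel E) v).target)
    (w : E × (ℂ →L[ℂ] ℂ)) :
    p.2 (localForm (contraction σ) v.1.proj p.1 w.1) =
      σ.inChart v p ![eulerField E p, w] := by
  rw [← dual_apply_mfderiv_proj (contraction σ) hp w, DiffForm.inChart_apply]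
  refine (contraction_center hσ _ _).trans ?_
  rw [← chartFrame_eulerField hp]
  congr 1
  funext i
  fin_cases i <;> rfl

theorem contDiffAt_contraction (hol : σ.IsHolomorphic) (hσ : IsEquivariant L σ) (x : X) :
    ContDiffAt ℂ ω (localForm (contraction σ) x) (extChartAt 𝓘(ℂ, E) x x) := by
  set v := unitPoint L x
  set y := extChartAt 𝓘(ℂ, E) x x with hy
  have hp : (y, ContinuousLinearMap.id ℂ ℂ) ∈ (extChartAt (dualModel E) v).target := by
    have h := unit_mem_dual_chart_target (mem_extChartAt_target (I := dualModel E) v)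
    rwa [dual_chart_apply] at h
  have hι : ContDiff ℂ ω (fun z : E ↦ ((z, ContinuousLinearMap.id ℂ ℂ) : E × (ℂ →L[ℂ] ℂ))) :=
    contDiff_id.prodMk contDiff_const
  have h1 := (hol.contDiffAt hp).interior_linear (eulerField E)
  have h2 : ContDiffAt ℂ ω (fun z : E ↦ (oneFormEquiv _).symm
      ((σ.inChart v (z, ContinuousLinearMap.id ℂ ℂ)).curryLeft
        (eulerField E (z, ContinuousLinearMap.id ℂ ℂ)))) y :=
    ContDiffAt.comp (f := fun z : E ↦ ((z, ContinuousLinearMap.id ℂ ℂ) : E × (ℂ →L[ℂ] ℂ))) y h1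
      hι.contDiffAt
  have h3 := h2.clm_comp (contDiffAt_const (c := ContinuousLinearMap.inl ℂ E (ℂ →L[ℂ] ℂ)))
  refine h3.congr_of_eventuallyEq ?_
  filter_upwards [hι.continuous.continuousAt.eventually
    ((isOpen_extChartAt_target v).mem_nhds hp)] with z hz
  ext u
  refine (localForm_contraction hσ hz (u, 0)).trans ?_
  rw [ContinuousLinearMap.comp_apply, ← oneFormEquiv_apply ((oneFormEquiv _).symm _),
    LinearIsometryEquiv.apply_symm_apply]
  rfl

variable [∀ x, IsTopologicalAddGroup (L x)] [∀ x, ContinuousSMul ℂ (L x)]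

/-- The twisted 1-form defined by an equivariant holomorphic 2-form on `L^×`. -/
def contractionForm (hol : σ.IsHolomorphic) (hσ : IsEquivariant L σ) : TwistedOneForm E L :=
  ⟨contraction σ, fun x ↦ (contMDiffAt_iff_localForm (contraction σ) (mem_extChartAt_source x)
    (FiberBundle.mem_baseSet_trivializationAt' x)).2 (contDiffAt_contraction hol hσ x)⟩

theorem pull_contractionForm_inChart (hol : σ.IsHolomorphic) (hσ : IsEquivariant L σ)
    {v : puncturedDual L} {p : E × (ℂ →L[ℂ] ℂ)}
    (hp : p ∈ (extChartAt (dualModel E) v).target) :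
    (contractionForm hol hσ).pull.inChart v p = (σ.inChart v p).curryLeft (eulerField E p) :=
  oneForm_ext fun w ↦ (TwistedOneForm.pull_inChart _ hp w).trans (localForm_contraction hσ hp w)

/-- A closed equivariant 2-form is the exterior derivative of its interior product with the
Euler field. -/
theorem pull_d_contractionForm (hol : σ.IsHolomorphic) (hd : σ.d = 0) (hσ : IsEquivariant L σ) :
    (contractionForm hol hσ).pull.d = σ := by
  refine DiffForm.ext_inChart fun v w ↦ ?_
  have hp := mem_extChartAt_target (I := dualModel E) v
  set p := extChartAt (dualModel E) v v
  have hw : w = ![w 0, w 1] := by funext i; fin_cases i <;> rfl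
  have heq : (contractionForm hol hσ).pull.inChart v =ᶠ[𝓝 p]
      fun q ↦ (σ.inChart v q).curryLeft (eulerField E q) := by
    filter_upwards [(isOpen_extChartAt_target v).mem_nhds hp] with q hq
    exact pull_contractionForm_inChart hol hσ hq
  have hclosed : extDeriv (σ.inChart v) p = 0 := by
    rw [← DiffForm.inChart_d hol hp, hd]
    rfl
  rw [DiffForm.inChart_d (TwistedOneForm.isHolomorphic_pull _) hp, heq.extDeriv_eq, hw,
    extDeriv_curryLeft (hol.contDiffAt hp) hclosed]
  refine lieDeriv_eq_of_homogeneous ((hol.contDiffAt hp).differentiableAt (by simp)) _ ?_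
  filter_upwards [isOpen_compl_singleton.mem_nhds (one_ne_zero : (1 : ℂ) ≠ 0)] with c hc
  have := inChart_pair_of_isEquivariant hσ hp hc (w 0) (w 1)
  rwa [fibreScaling_eq, fibreScaling_eq, fibreScaling_eq] at this

/-- A twisted 1-form `θ` is determined by `d(p^*θ)`. -/
theorem TwistedOneForm.pull_d_injective :
    Function.Injective fun θ : TwistedOneForm E L ↦ θ.pull.d := by
  intro θ₁ θ₂ h
  have h : θ₁.pull.d = θ₂.pull.d := h
  refine ContMDiffSection.ext fun x ↦ ?_
  have hp := mem_extChartAt_target (I := dualModel E) (unitPoint L x)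
  have hp1 : (extChartAt (dualModel E) (unitPoint L x) (unitPoint L x)).1 =
      extChartAt 𝓘(ℂ, E) x x := by
    rw [dual_chart_apply]
    rfl
  ext u
  -- Pairing with the unit vertical vector over `x` gives the value of `θ` at `x`.
  have h1 : ∀ θ : TwistedOneForm E L,
      θ.pull.d.inChart (unitPoint L x) (extChartAt (dualModel E) (unitPoint L x) (unitPoint L x))
        ![(0, ContinuousLinearMap.id ℂ ℂ), (u, 0)] =
      (trivializationAt ℂ L x).continuousLinearMapAt ℂ x (θ x u) := by
    intro θ
    have e0 : extDeriv (θ.localExpr x) (extChartAt 𝓘(ℂ, E) x x) ![0, u] = 0 :=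
      (extDeriv (θ.localExpr x) (extChartAt 𝓘(ℂ, E) x x)).map_coord_zero 0 rfl
    have e1 : θ.pull.d.inChart (unitPoint L x)
        (extChartAt (dualModel E) (unitPoint L x) (unitPoint L x))
        ![(0, ContinuousLinearMap.id ℂ ℂ), (u, 0)] =
      (extChartAt (dualModel E) (unitPoint L x) (unitPoint L x)).2
        (extDeriv (θ.localExpr x) (extChartAt 𝓘(ℂ, E) x x) ![0, u]) +
        θ.localExpr x (extChartAt 𝓘(ℂ, E) x x) ![u] - 0 := by
      rw [TwistedOneForm.pull_d_inChart θ hp, hp1]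
      rfl
    rw [e1, e0, map_zero, zero_add, sub_zero]
    exact (TwistedOneForm.localExpr_apply θ x _ u).trans (localForm_self θ x u)
  have h2 := (h1 θ₁).symm.trans ((by rw [h]) : _ = _) |>.trans (h1 θ₂)
  have hb := FiberBundle.mem_baseSet_trivializationAt' (F := ℂ) (E := L) x
  have := congrArg ((trivializationAt ℂ L x).symmL ℂ x) h2
  rwa [Bundle.Trivialization.symmL_continuousLinearMapAt _ hb,
    Bundle.Trivialization.symmL_continuousLinearMapAt _ hb] at this

end Contraction

end

theorem mainTheorem5 {E : Type*} [NormedAddCommGroup E] [NormedSpace ℂ E] [FiniteDimensional ℂ E]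
    {X : Type*} [TopologicalSpace X] [ChartedSpace E X] [IsManifold 𝓘(ℂ, E) ω X]
    (L : X → Type*) [∀ x, AddCommGroup (L x)] [∀ x, Module ℂ (L x)] [∀ x, TopologicalSpace (L x)]
    [∀ x, IsTopologicalAddGroup (L x)] [∀ x, ContinuousSMul ℂ (L x)]
    [TopologicalSpace (Bundle.TotalSpace ℂ L)] [FiberBundle ℂ L] [VectorBundle ℂ ℂ L]
    [ContMDiffVectorBundle ω ℂ L 𝓘(ℂ, E)] :
    (∀ θ : TwistedOneForm E L, θ.IsContact →
      θ.pull.d.IsSymplectic ∧ IsEquivariant L θ.pull.d) ∧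
    (∀ σ : DiffForm (dualModel E) (puncturedDual L) 2, σ.IsSymplectic → IsEquivariant L σ →
      ∃! θ : TwistedOneForm E L, θ.IsContact ∧ σ = θ.pull.d) := by
  refine ⟨fun θ hθ ↦ ⟨TwistedOneForm.isSymplectic_pull_d hθ, θ.isEquivariant_pull_d⟩,
    fun σ hσ heq ↦ ?_⟩
  have h := pull_d_contractionForm hσ.holomorphic hσ.closed heq
  refine ⟨contractionForm hσ.holomorphic heq, ⟨?_, h.symm⟩,
    fun θ hθ ↦ TwistedOneForm.pull_d_injective (hθ.2.symm.trans h.symm)⟩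
  rw [TwistedOneForm.isContact_iff, h]
  exact hσ.nondegenerate
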